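/- \textbf{Setting.} There are $N$ players; player $i$ chooses $x^i\in\mathbb R^{n_i}$, and $x=(x^i,x^{-i})=\mathrm{col}\{x^i\}\in\mathbb R^n$, $n=\sum_i n_i$. Player $i$ minimizes $J_i(x^i,x^{-i})$ over $x^i$ subject to $x\in X=\{x: g(x)\le 0\}$, where $g(x)=\sum_i g_i(x^i)$, $g_i:\mathbb R^{n_i}\to\mathbb R^m$. For every $i$, $J_i$ is continuously differentiable and convex in $x^i$ given $x^{-i}$, $g_i$ is differentiable and (componentwise) convex, and $X$ is nonempty and satisfies Slater's condition (there is $x$ with $g(x)<0$ componentwise). A point $x^*\in X$ is a generalized Nash equilibrium if $x^{i,*}$ minimizes $J_i(\cdot,x^{-i,*})$ over $\{x^i:(x^i,x^{-i,*})\in X\}$ for all $i$. As usual in this context, GNE means variational GNE: in addition there is one $\lambda_c\in\mathbb R^m_+$ with $\nabla_{x^i}J_i(x^*)+\nabla g_i(x^{i,*})^T\lambda_c=0$ for all $i$ and $g(x^*)\in\mathcal N_{\mathbb R^m_+}(\lambda_c)$, where $\mathcal N$ denotes the normal cone. Put $F(x)=\mathrm{col}\{\nabla_{x^i}J_i(x^i,x^{-i})\}$,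 $G(x)=\mathrm{col}\{g_i(x^i)\}$, $\nabla G(x)=\mathrm{blkdiag}\{\nabla g_i(x^i)\}$ (Jacobians), and $L=\mathcal L\otimes I_m$, where $\mathcal L$ is the Laplacian matrix of a connected weighted undirected graph on the players. $F$ is monotone: $\langle x-y,F(x)-F(y)\rangle\ge 0$ for all $x,y$. \textbf{Compensators.} For each $i$ three linear systems $\dot\xi=\Phi\xi+\Theta u$, $w=\Psi\xi+\Gamma u$ are given: $H_i$ with $n_i$ inputs and outputs, and $\bar H_i,\hat H_i$ with $m$ inputs and outputs. Each is a minimal realization with $\Phi$ invertible, $\Theta$ of full column rank, $\Psi$ of full row rank and transfer function vanishing at $s=0$. Each is output strictly passive with respect to $V(\xi)=\frac12\xi^TP\xi$ for a given positive definite $P$, i.e. $\dot V\le u^Tw-\delta w^Tw$ for some $\delta>0$ and all $(\xi,u)$. For each, the output stays at zero only if the state is constant. Stacking over $i$, let $w_x,\xi_x$ be the output and state of $\mathrm{blkdiag}\{H_i\}$ with input $x$; $w_\lambda,\xi_\lambda$ those of $\mathrm{blkdiag}\{\bar H_i\}$ with input $\lambda$; $w_z,\xi_z$ those of $\mathrm{blkdiag}\{\hat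 H_i\}$ with input $z$; let $P_{\xi_x},P_{\xi_\lambda},P_{\xi_z}$ be the corresponding block diagonal matrices. \textbf{Dynamics.} With $\tilde m=Nm$ and $\Pi_\Omega(\lambda,v)$ the projection of $v$ on the tangent cone of $\Omega$ at $\lambda$, consider, together with the compensator equations, $$\dot x=-F(x)-\nabla G(x)^T\lambda-w_x,\quad \dot\lambda=\Pi_{\mathbb R^{\tilde m}_+}\big(\lambda,\,G(x)-Lz-L\lambda-w_\lambda\big),\quad \dot z=L\lambda-w_z\qquad(\ast)$$ with $\lambda(0)\in\mathbb R^{\tilde m}_+$ (a trajectory is a locally absolutely continuous function on $[0,\infty)$ with $\lambda(t)\in\mathbb R_+^{\tilde m}$ that satisfies $(\ast)$ and the compensator equations almost everywhere). Suppose that $(\ast)$ has an equilibrium point, and let $(x^*,\xi_x^*,\lambda^*,\xi_\lambda^*,z^*,\xi_z^*)$ be any equilibrium point. Let $\Sigma_x$ be the system $\dot x=-F(x)+u_x-w_x$ with its compensators, input $u_x$ and output $y_x=x$; let $\Sigma_{\lambda z}$ be the system $\dot\lambda=\Pi_{\mathbb R^{\tilde m}_+}(\lambda,G(u_{\lambda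 z})-Lz-L\lambda-w_\lambda)$, $\dot z=L\lambda-w_z$ with its compensators, state constraint $\lambda\in\mathbb R^{\tilde m}_+$, input $u_{\lambda z}$ and output $y_{\lambda z}=\nabla G(u_{\lambda z})^T\lambda$. Put $u_x^*=-\nabla G(x^*)^T\lambda^*$, $y_x^*=x^*$, $u_{\lambda z}^*=x^*$, $y_{\lambda z}^*=\nabla G(x^*)^T\lambda^*$. A system is called passive from $u-u^*$ to $y-y^*$ with respect to a storage function $S$ if its state at the given equilibrium point is an equilibrium for the constant input $u^*$, $S$ is continuously differentiable, positive definite around that state and radially unbounded, and $\dot S\le\langle u-u^*,y-y^*\rangle$ for all admissible states and all inputs. \textbf{Theorem.} (i) $\Sigma_x$ is passive from $u_x-u_x^*$ to $y_x-y_x^*$ with respect to $S_x=\frac12\|x-x^*\|^2+\frac12(\xi_x-\xi_x^*)^TP_{\xi_x}(\xi_x-\xi_x^*)$. (ii) $\Sigma_{\lambda z}$ is passive from $u_{\lambda z}-u_{\lambda z}^*$ to $y_{\lambda z}-y_{\lambda z}^*$ with respect to $S_{\lambda z}=\frac12\|\lambda-\lambda^*\|^2+\frac12(\xi_\lambda-\xi_\lambda^*)^TP_{\xi_\lambda}(\xi_\lambda-\xi_\lambda^*)+\frac12\|z-z^*\|^2+\frac12(\xi_z-\xi_z^*)^TP_{\xi_z}(\xi_z-\xi_z^*)$.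 (iii) Every trajectory of $(\ast)$ converges, as $t\to\infty$, to an equilibrium point of $(\ast)$, and the $x$-component of that equilibrium point is a (variational) GNE. -/

import Mathlib

open Set Filter Topology MeasureTheory
open scoped RealInnerProductSpace

namespace GNESeeking

noncomputable section

/-! ### Euclidean vectors and stacked block vectors -/

/-- Euclidean space of column vectors with `k` real entries. -/
abbrev Vec (k : ℕ) : Type := EuclideanSpace ℝ (Fin k)

/-- Stacked vectors `col{v_1, ..., v_N}` with `v_i ∈ ℝ^{d_i}`, carrying the Euclidean norm and the
Euclidean inner product of the stacked vector. -/
abbrev Blocks {N : ℕ} (d : Fin N → ℕ) : Type := PiLp 2 (fun i : Fin N => Vec (d i))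

/-- Stacked vectors of `N` blocks that all have length `m`. -/
abbrev UBlocks (N m : ℕ) : Type := Blocks (fun _ : Fin N => m)

/-- `col{f_i}`. -/
def col {N : ℕ} {d : Fin N → ℕ} (f : ∀ i, Vec (d i)) : Blocks d := WithLp.toLp 2 f

/-- The profile `(y, x^{-i})`: block `i` of `x` is replaced by `y`. -/
def replaceBlock {N : ℕ} {d : Fin N → ℕ} (x : Blocks d) (i : Fin N) (y : Vec (d i)) : Blocks d :=
  WithLp.toLp 2 (Function.update x.ofLp i y)

/-- The nonnegative orthant of `ℝ^k`. -/
def nonnegVec (k : ℕ) : Set (Vec k) := {v | ∀ j, 0 ≤ v j}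

/-- The nonnegative orthant of the space of stacked vectors. -/
def nonnegBlocks (N m : ℕ) : Set (UBlocks N m) := {v | ∀ i j, 0 ≤ v i j}

/-! ### Convex analysis -/

section Convex

variable {E : Type*} [NormedAddCommGroup E] [InnerProductSpace ℝ E]

/-- Normal cone of `Ω` at `x`. -/
def normalCone (Ω : Set E) (x : E) : Set E := {v | ∀ y ∈ Ω, ⟪v, y - x⟫ ≤ 0}

open Classical in
/-- Metric projection `argmin_{y ∈ Ω} ‖y - x‖` (it exists and is unique when `Ω` is a nonempty
closed convex subset of a Euclidean space; the value `x` is used when there is no minimizer). -/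
def metricProj (Ω : Set E) (x : E) : E :=
  if h : ∃ p ∈ Ω, ∀ y ∈ Ω, ‖p - x‖ ≤ ‖y - x‖ then h.choose else x

/-- The differentiated projection `Π_Ω(x, v)`: the projection of `v` on the tangent cone
of `Ω` at `x`. -/
def diffProj (Ω : Set E) (x v : E) : E := metricProj (posTangentConeAt Ω x) v

/-- Monotone operators. -/
def IsMonotoneOp (F : E → E) : Prop := ∀ x y, 0 ≤ ⟪x - y, F x - F y⟫

end Convex

/-! ### The game -/

/-- The data of a game with `N` players: player `i` chooses `x^i ∈ ℝ^{n_i}`, has the cost function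
`J_i`, and contributes `g_i(x^i) ∈ ℝ^m` to the coupling constraint. -/
structure Game {N : ℕ} (n : Fin N → ℕ) (m : ℕ) where
  /-- the cost functions `J_i` -/
  J : Fin N → Blocks n → ℝ
  /-- the constraint functions `g_i` -/
  g : ∀ i, Vec (n i) → Vec m

namespace Game

variable {N : ℕ} {n : Fin N → ℕ} {m : ℕ} (Γ : Game n m)

/-- `g(x) = ∑ i, g_i(x^i)`. -/
def gSum (x : Blocks n) : Vec m := ∑ i, Γ.g i (x i)

/-- The coupling constraint set `X = {x | g(x) ≤ 0}`. -/
def feasible : Set (Blocks n) := {x | ∀ k, Γ.gSum x k ≤ 0}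

/-- The pseudo-gradient `F(x) = col{∇_{x^i} J_i(x^i, x^{-i})}`. -/
def F (x : Blocks n) : Blocks n :=
  col fun i => gradient (fun y => Γ.J i (replaceBlock x i y)) (x i)

/-- `G(x) = col{g_i(x^i)}`. -/
def G (x : Blocks n) : UBlocks N m := col fun i => Γ.g i (x i)

/-- `∇G(x)ᵀ lam = col{∇g_i(x^i)ᵀ lam^i}`, where `∇g_i(x^i)` is the Jacobian of `g_i` at `x^i`. -/
def gradGT (x : Blocks n) (lam : UBlocks N m) : Blocks n :=
  col fun i => ContinuousLinearMap.adjoint (fderiv ℝ (Γ.g i) (x i)) (lam i)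

/-- Regularity of the game: `J_i` is continuously differentiable and convex in `x^i`
given `x^{-i}`, `g_i` is differentiable and convex (componentwise), and the constraint set is
nonempty and satisfies Slater's constraint qualification. -/
structure Regular : Prop where
  cost_contDiff : ∀ i x, ContDiff ℝ 1 fun y => Γ.J i (replaceBlock x i y)
  cost_convex : ∀ i x, ConvexOn ℝ univ fun y => Γ.J i (replaceBlock x i y)
  constr_differentiable : ∀ i, Differentiable ℝ (Γ.g i)
  constr_convex : ∀ i k, ConvexOn ℝ univ fun y => Γ.g i y k
  feasible_nonempty : Γ.feasible.Nonempty
  slater : ∃ x, ∀ k, Γ.gSum x k < 0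

/-- Generalized Nash equilibrium. -/
def IsGNE (x : Blocks n) : Prop :=
  x ∈ Γ.feasible ∧
    ∀ i y, replaceBlock x i y ∈ Γ.feasible → Γ.J i x ≤ Γ.J i (replaceBlock x i y)

/-- Variational generalized Nash equilibrium: a generalized Nash equilibrium whose KKT conditions
hold with one multiplier that is common to all players. -/
def IsVariationalGNE (x : Blocks n) : Prop :=
  Γ.IsGNE x ∧ ∃ lam ∈ nonnegVec m,
    (∀ i, gradient (fun y => Γ.J i (replaceBlock x i y)) (x i) +
      ContinuousLinearMap.adjoint (fderiv ℝ (Γ.g i) (x i)) lam = 0) ∧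
    Γ.gSum x ∈ normalCone (nonnegVec m) lam

end Game

/-! ### The communication graph -/

/-- A weighted undirected graph on the players, without self-loops. -/
structure Network (N : ℕ) where
  /-- the underlying graph -/
  graph : SimpleGraph (Fin N)
  /-- the adjacency matrix `[a_ij]` -/
  a : Matrix (Fin N) (Fin N) ℝ
  a_symm : ∀ i j, a i j = a j i
  a_pos : ∀ i j, graph.Adj i j → 0 < a i j
  a_zero : ∀ i j, ¬ graph.Adj i j → a i j = 0

namespace Network

variable {N : ℕ} (net : Network N)

/-- The Laplacian matrix: the diagonal matrix of weighted degrees minus the adjacency matrix. -/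
def laplacian : Matrix (Fin N) (Fin N) ℝ :=
  Matrix.diagonal (fun i => ∑ j, net.a i j) - net.a

/-- The action of the Kronecker product of the Laplacian matrix with the identity `I_m`. -/
def L {m : ℕ} (v : UBlocks N m) : UBlocks N m :=
  col fun i => ∑ j, net.laplacian i j • v j

end Network

/-! ### Linear compensators -/

/-- The system `ξ' = A ξ + B u`, `w = C ξ + D u` with `p` states, `q` inputs and `q` outputs. -/
structure LTI (p q : ℕ) where
  /-- the state matrix -/
  A : Matrix (Fin p) (Fin p) ℝ
  /-- the input matrix -/
  B : Matrix (Fin p) (Fin q) ℝ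
  /-- the output matrix -/
  C : Matrix (Fin q) (Fin p) ℝ
  /-- the feedthrough matrix -/
  D : Matrix (Fin q) (Fin q) ℝ

/-- The quadratic storage function `½ ξᵀ P ξ`. -/
def quadStorage {p : ℕ} (P : Matrix (Fin p) (Fin p) ℝ) (ξ : Vec p) : ℝ :=
  (1 / 2) * (ξ.ofLp ⬝ᵥ P.mulVec ξ.ofLp)

namespace LTI

variable {p q : ℕ} (H : LTI p q)

/-- The right-hand side `A ξ + B u` of the state equation. -/
def field (ξ : Vec p) (u : Vec q) : Vec p :=
  WithLp.toLp 2 (H.A.mulVec ξ.ofLp + H.B.mulVec u.ofLp)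

/-- The output `C ξ + D u`. -/
def out (ξ : Vec p) (u : Vec q) : Vec q :=
  WithLp.toLp 2 (H.C.mulVec ξ.ofLp + H.D.mulVec u.ofLp)

/-- The controllability matrix `[B, AB, ..., A^{p-1} B]` has full rank. -/
def Controllable : Prop :=
  (Matrix.of fun (i : Fin p) (kj : Fin p × Fin q) => (H.A ^ (kj.1 : ℕ) * H.B) i kj.2).rank = p

/-- The observability matrix, with blocks `C, CA, ..., C A^{p-1}`, has full rank. -/
def Observable : Prop :=
  (Matrix.of fun (kj : Fin p × Fin q) (i : Fin p) => (H.C * H.A ^ (kj.1 : ℕ)) kj.2 i).rank = p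

/-- The transfer function `H(s) = C (s I - A)⁻¹ B + D`. -/
def transfer (s : ℂ) : Matrix (Fin q) (Fin q) ℂ :=
  H.C.map Complex.ofReal * (s • (1 : Matrix (Fin p) (Fin p) ℂ) - H.A.map Complex.ofReal)⁻¹ *
    H.B.map Complex.ofReal + H.D.map Complex.ofReal

/-- Output strict passivity with respect to the storage function `V(ξ) = ½ ξᵀ P ξ`, with `P`
positive definite: `V' ≤ uᵀ w - δ wᵀ w` along the system, for some `δ > 0`. -/
def OutputStrictlyPassive (P : Matrix (Fin p) (Fin p) ℝ) : Prop :=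
  P.PosDef ∧ ∃ δ : ℝ, 0 < δ ∧ ∀ ξ u,
    fderiv ℝ (quadStorage P) ξ (H.field ξ u) ≤ ⟪u, H.out ξ u⟫ - δ * ⟪H.out ξ u, H.out ξ u⟫

/-- The output stays at zero only if the state is constant: whenever a trajectory `ξ` on `[0, ∞)`
that is driven by a continuous input has zero output at all times, `ξ` is constant. -/
def ZeroOutputOnlyAtConstantState : Prop :=
  ∀ (u : ℝ → Vec q) (ξ : ℝ → Vec p), ContinuousOn u (Ici 0) →
    (∀ t, 0 ≤ t → HasDerivWithinAt ξ (H.field (ξ t) (u t)) (Ici 0) t) →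
    (∀ t, 0 ≤ t → H.out (ξ t) (u t) = 0) →
    ∀ t, 0 ≤ t → ξ t = ξ 0

/-- The requirements on a compensator: a minimal realization with invertible state matrix, input
matrix of full column rank and output matrix of full row rank; `H(0) = 0`; output strict passivity
with respect to `½ ξᵀ P ξ`; zero output only at constant states. -/
structure IsCompensator (P : Matrix (Fin p) (Fin p) ℝ) : Prop where
  controllable : H.Controllable
  observable : H.Observable
  isUnit_A : IsUnit H.A
  rank_B : H.B.rank = q
  rank_C : H.C.rank = q
  transfer_zero : H.transfer 0 = 0
  outputStrictlyPassive : H.OutputStrictlyPassive P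
  zeroOutput : H.ZeroOutputOnlyAtConstantState

end LTI

section Bank

variable {N : ℕ} {p d : Fin N → ℕ}

/-- Right-hand side of the state equation of a bank of compensators (block diagonal matrices). -/
def bankField (H : ∀ i, LTI (p i) (d i)) (ξ : Blocks p) (u : Blocks d) : Blocks p :=
  col fun i => (H i).field (ξ i) (u i)

/-- Output of a bank of compensators. -/
def bankOut (H : ∀ i, LTI (p i) (d i)) (ξ : Blocks p) (u : Blocks d) : Blocks d :=
  col fun i => (H i).out (ξ i) (u i)

/-- `½ ξᵀ P ξ` with `P = blkdiag{P_i}`. -/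
def bankStorage (P : ∀ i, Matrix (Fin (p i)) (Fin (p i)) ℝ) (ξ : Blocks p) : ℝ :=
  ∑ i, quadStorage (P i) (ξ i)

end Bank

/-! ### Passivity -/

/-- The system `s' = f(s, u)`, `y = h(s, u)` with state constrained to `Ω` has the equilibrium
state `s₀` under the constant input `u₀`, and it is passive from `u - u₀` to `y - h(s₀, u₀)` with
respect to the storage function `V`, which is continuously differentiable, positive definite
around `s₀` and radially unbounded. The derivative of `V` along the system is `∇V(s)ᵀ f(s, u)`. -/
structure IsPassiveAt {S U : Type*} [NormedAddCommGroup S] [NormedSpace ℝ S]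
    [NormedAddCommGroup U] [InnerProductSpace ℝ U]
    (Ω : Set S) (f : S → U → S) (h : S → U → U) (V : S → ℝ) (s₀ : S) (u₀ : U) : Prop where
  mem : s₀ ∈ Ω
  equilibrium : f s₀ u₀ = 0
  contDiff : ContDiff ℝ 1 V
  zero : V s₀ = 0
  pos : ∀ s, s ≠ s₀ → 0 < V s
  radiallyUnbounded : Tendsto V (cocompact S) atTop
  dissipation : ∀ s ∈ Ω, ∀ u, fderiv ℝ V s (f s u) ≤ ⟪u - u₀, h s u - h s₀ u₀⟫

/-! ### The dynamics -/

section Dynamics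

variable {N m : ℕ} {n p r q : Fin N → ℕ}

/-- States `(x, ξ_x)`. -/
abbrev StateX {N : ℕ} (n p : Fin N → ℕ) : Type := Blocks n × Blocks p

/-- States `((lam, ξ_lam), (z, ξ_z))`. -/
abbrev StateLZ {N : ℕ} (m : ℕ) (r q : Fin N → ℕ) : Type :=
  (UBlocks N m × Blocks r) × (UBlocks N m × Blocks q)

/-- States `((x, ξ_x), ((lam, ξ_lam), (z, ξ_z)))` of the whole dynamics. -/
abbrev State {N : ℕ} (n p : Fin N → ℕ) (m : ℕ) (r q : Fin N → ℕ) : Type :=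
  StateX n p × StateLZ m r q

/-- The constraint `lam ≥ 0` on the states of the second subsystem. -/
def domainLZ (m : ℕ) (r q : Fin N → ℕ) : Set (StateLZ m r q) := {s | s.1.1 ∈ nonnegBlocks N m}

/-- The constraint `lam ≥ 0` on the states of the whole dynamics. -/
def domain (n p : Fin N → ℕ) (m : ℕ) (r q : Fin N → ℕ) : Set (State n p m r q) :=
  {s | s.2.1.1 ∈ nonnegBlocks N m}

/-- The first subsystem, from the input `u_x`:
`x' = - F(x) + u_x - w_x`, `ξ_x' = Φ ξ_x + Θ x`, `w_x = Ψ ξ_x + Γ x`. -/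
def sigmaXField (Γ : Game n m) (Hx : ∀ i, LTI (p i) (n i))
    (s : StateX n p) (u : Blocks n) : StateX n p :=
  (-Γ.F s.1 + u - bankOut Hx s.2 s.1, bankField Hx s.2 s.1)

/-- The output `y_x = x` of the first subsystem. -/
def sigmaXOut (s : StateX n p) (_u : Blocks n) : Blocks n := s.1

/-- The second subsystem, from the input `u_{lam z}`:
`lam' = Π[lam, G(u_{lam z}) - L z - L lam - w_lam]`, `z' = L lam - w_z`, with the compensators that
produce `w_lam` from `lam` and `w_z` from `z`. -/
def sigmaLZField (Γ : Game n m) (net : Network N) (Hl : ∀ i, LTI (r i) m) (Hz : ∀ i, LTI (q i) m)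
    (s : StateLZ m r q) (u : Blocks n) : StateLZ m r q :=
  ((diffProj (nonnegBlocks N m) s.1.1
      (Γ.G u - net.L s.2.1 - net.L s.1.1 - bankOut Hl s.1.2 s.1.1),
    bankField Hl s.1.2 s.1.1),
   (net.L s.1.1 - bankOut Hz s.2.2 s.2.1,
    bankField Hz s.2.2 s.2.1))

/-- The output `y_{lam z} = ∇G(u_{lam z})ᵀ lam` of the second subsystem. -/
def sigmaLZOut (Γ : Game n m) (s : StateLZ m r q) (u : Blocks n) : Blocks n :=
  Γ.gradGT u s.1.1

/-- The storage function
`½ ‖x - x*‖² + ½ (ξ_x - ξ_x*)ᵀ P_x (ξ_x - ξ_x*)` of the first subsystem. -/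
def storageX (Px : ∀ i, Matrix (Fin (p i)) (Fin (p i)) ℝ) (e s : StateX n p) : ℝ :=
  (1 / 2) * ‖s.1 - e.1‖ ^ 2 + bankStorage Px (s.2 - e.2)

/-- The storage function `½ ‖lam - lam*‖² + ½ (ξ_lam - ξ_lam*)ᵀ P_lam (ξ_lam - ξ_lam*)
+ ½ ‖z - z*‖² + ½ (ξ_z - ξ_z*)ᵀ P_z (ξ_z - ξ_z*)` of the second subsystem. -/
def storageLZ (Pl : ∀ i, Matrix (Fin (r i)) (Fin (r i)) ℝ)
    (Pz : ∀ i, Matrix (Fin (q i)) (Fin (q i)) ℝ) (e s : StateLZ m r q) : ℝ :=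
  (1 / 2) * ‖s.1.1 - e.1.1‖ ^ 2 + bankStorage Pl (s.1.2 - e.1.2) +
    ((1 / 2) * ‖s.2.1 - e.2.1‖ ^ 2 + bankStorage Pz (s.2.2 - e.2.2))

/-- The right-hand side of the gradient-play dynamics with output feedback compensators:
`x' = - F(x) - ∇G(x)ᵀ lam - w_x`, `lam' = Π[lam, G(x) - L z - L lam - w_lam]`,
`z' = L lam - w_z`, together with the three banks of compensators. -/
def dynamics (Γ : Game n m) (net : Network N) (Hx : ∀ i, LTI (p i) (n i))
    (Hl : ∀ i, LTI (r i) m) (Hz : ∀ i, LTI (q i) m) (s : State n p m r q) : State n p m r q :=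
  let x := s.1.1
  let ξx := s.1.2
  let lam := s.2.1.1
  let ξl := s.2.1.2
  let z := s.2.2.1
  let ξz := s.2.2.2
  ((-Γ.F x - Γ.gradGT x lam - bankOut Hx ξx x,
    bankField Hx ξx x),
   ((diffProj (nonnegBlocks N m) lam (Γ.G x - net.L z - net.L lam - bankOut Hl ξl lam),
     bankField Hl ξl lam),
    (net.L lam - bankOut Hz ξz z,
     bankField Hz ξz z)))

/-- Equilibrium points of the dynamics. -/
def IsEquilibrium (Γ : Game n m) (net : Network N) (Hx : ∀ i, LTI (p i) (n i))
    (Hl : ∀ i, LTI (r i) m) (Hz : ∀ i, LTI (q i) m) (e : State n p m r q) : Prop :=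
  e ∈ domain n p m r q ∧ dynamics Γ net Hx Hl Hz e = 0

/-- Trajectories on `[0, ∞)`. The projection makes the right-hand side discontinuous, so solutions
are meant in the sense of Carathéodory: locally absolutely continuous, staying in the set
`lam ≥ 0` on which the right-hand side is defined, and satisfying the differential equation at
almost every time. -/
structure IsTrajectory (Γ : Game n m) (net : Network N) (Hx : ∀ i, LTI (p i) (n i))
    (Hl : ∀ i, LTI (r i) m) (Hz : ∀ i, LTI (q i) m) (s : ℝ → State n p m r q) : Prop where
  mem_domain : ∀ t, 0 ≤ t → s t ∈ domain n p m r q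
  absolutelyContinuous : ∀ T, 0 ≤ T → AbsolutelyContinuousOnInterval s 0 T
  hasDerivAt : ∀ᵐ t ∂volume, 0 < t → HasDerivAt s (dynamics Γ net Hx Hl Hz (s t)) t

end Dynamics

end

end GNESeeking

open GNESeeking

/-! ### Mean value estimates for absolutely continuous curves -/

section AbsolutelyContinuous

/-! Passivity of the first subsystem rests on monotonicity of `F`, that of the second on convexity
of the `g_i`: the saddle operator `(x, λ) ↦ (∇G(x)ᵀ λ, -G(x))` is monotone for `λ ≥ 0`
(`Game.Regular.inner_G_sub_le`). The Laplacian is positive semidefinite, its skew coupling of `λ`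
and `z` cancels, and the projection only helps (`inner_sub_diffProj_le`). A compensator is linear
with zero gain at `s = 0`, so its output vanishes at every equilibrium and its output strict
passivity carries over to deviations from any equilibrium (`exists_fderiv_storageX_le`). The
subsystems form a negative feedback loop, so their supply rates cancel, and the total storage `S`
satisfies `S' ≤ -φ` with `φ` a weighted sum of the squared compensator outputs.

Convergence then needs an invariance argument. If a compensator output stays zero, its state is
constant, and since the input matrix is injective so is its input, which is `x`, `λ` or `z`. The
projected field is discontinuous, so limit curves need not obviously solve the dynamics.
`IsCaratheodorySolution.exists_tendsto_equilibrium` therefore uses limits of time shifts of the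
trajectory along an ultrafilter: such a limit curve lies in `φ = 0` and still obeys the linear
compensator equations, which already makes it constant. Its value is an equilibrium, because a drift
in a fixed direction near it would push the trajectory away. As `S` may be centred at any
equilibrium, it may be centred at this one; it is then nonincreasing with limit zero along the
ultrafilter, hence tends to zero.

The field apart from the projection is continuous although the costs are smooth only in the players'
own variables: a monotone operator is continuous wherever its value is the only one compatible with
monotonicity. Equilibria are variational GNEs because the kernel of the Laplacian yields a common
multiplier, summation over the players removes `L z`, and convexity makes the KKT conditions
sufficient. -/

theorem AbsolutelyContinuousOnInterval.sub_le_of_ae_deriv_le {f : ℝ → ℝ} {a b c : ℝ}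
    (hab : a ≤ b) (hf : AbsolutelyContinuousOnInterval f a b)
    (h : ∀ᵐ t, t ∈ Ioc a b → ∃ d ≤ c, HasDerivAt f d t) : f b - f a ≤ c * (b - a) := by
  rw [← hf.integral_deriv_eq_sub, mul_comm, ← smul_eq_mul, ← intervalIntegral.integral_const]
  refine intervalIntegral.integral_mono_ae_restrict hab hf.intervalIntegrable_deriv
    intervalIntegrable_const ?_
  rw [Filter.EventuallyLE, ← Measure.restrict_congr_set Ioc_ae_eq_Icc,
    ae_restrict_iff' measurableSet_Ioc]
  filter_upwards [h] with t ht hmem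
  obtain ⟨d, hd, hfd⟩ := ht hmem
  rwa [hfd.deriv]

/-- Postcomposition of an absolutely continuous function with a map that is Lipschitz on its
range. -/
theorem LipschitzOnWith.comp_absolutelyContinuousOnInterval {X Y : Type*} [PseudoMetricSpace X]
    [PseudoMetricSpace Y] {g : X → Y} {f : ℝ → X} {K : NNReal} {S : Set X} {a b : ℝ}
    (hg : LipschitzOnWith K g S) (hfS : MapsTo f (uIcc a b) S)
    (hf : AbsolutelyContinuousOnInterval f a b) :
    AbsolutelyContinuousOnInterval (g ∘ f) a b := by
  rw [absolutelyContinuousOnInterval_iff] at hf ⊢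
  intro ε hε
  -- `K + 1` instead of `K` allows for `K = 0`.
  obtain ⟨δ, hδ, H⟩ := hf (ε / (K + 1)) (by positivity)
  refine ⟨δ, hδ, fun E hE hlt => ?_⟩
  have h1 := H E hE hlt
  calc _ ≤ ∑ i ∈ Finset.range E.1, (K : ℝ) * dist (f (E.2 i).1) (f (E.2 i).2) :=
        Finset.sum_le_sum fun i hi =>
          hg.dist_le_mul _ (hfS (hE.1 i hi).1) _ (hfS (hE.1 i hi).2)
    _ = K * ∑ i ∈ Finset.range E.1, dist (f (E.2 i).1) (f (E.2 i).2) := by rw [Finset.mul_sum]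
    _ ≤ K * (ε / (K + 1)) := by gcongr
    _ < (K + 1) * (ε / (K + 1)) := by gcongr; linarith
    _ = ε := by field

variable {E : Type*} [NormedAddCommGroup E] [NormedSpace ℝ E]

/-- The curve is bounded, and on a compact convex ball a `C^1` function is Lipschitz. -/
theorem AbsolutelyContinuousOnInterval.contDiff_comp [FiniteDimensional ℝ E] {V : E → ℝ}
    (hV : ContDiff ℝ 1 V) {s : ℝ → E} {a b : ℝ}
    (hs : AbsolutelyContinuousOnInterval s a b) : AbsolutelyContinuousOnInterval (V ∘ s) a b := by
  obtain ⟨R, hR⟩ := hs.exists_bound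
  have := FiniteDimensional.proper_real E
  obtain ⟨K, hK⟩ := hV.contDiffOn.exists_lipschitzOnWith (by decide)
    (convex_closedBall (0 : E) R) (isCompact_closedBall 0 R)
  exact hK.comp_absolutelyContinuousOnInterval (fun t ht => by simpa using hR t ht) hs

theorem AbsolutelyContinuousOnInterval.norm_sub_sub_le {s : ℝ → E} {a b M : ℝ} {c : E}
    (hab : a ≤ b) (hs : AbsolutelyContinuousOnInterval s a b)
    (h : ∀ᵐ t, t ∈ Ioc a b → ∃ d, ‖d - c‖ ≤ M ∧ HasDerivAt s d t) :
    ‖s b - s a - (b - a) • c‖ ≤ M * (b - a) := by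
  -- A norming functional reduces the vector estimate to the scalar one.
  obtain ⟨φ, hφ, hφv⟩ := exists_dual_vector'' ℝ (s b - s a - (b - a) • c)
  have hac : AbsolutelyContinuousOnInterval (fun t => φ (s t)) a b :=
    φ.lipschitz.lipschitzOnWith.comp_absolutelyContinuousOnInterval (mapsTo_univ _ _) hs
  have := hac.sub_le_of_ae_deriv_le (c := M + φ c) hab <| by
    filter_upwards [h] with t ht hmem
    obtain ⟨d, hd, hsd⟩ := ht hmem
    refine ⟨φ d, ?_, φ.hasFDerivAt.comp_hasDerivAt t hsd⟩
    have h1 : φ d - φ c ≤ M := by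
      rw [← map_sub]
      calc φ (d - c) ≤ ‖φ (d - c)‖ := le_abs_self _
        _ ≤ ‖φ‖ * ‖d - c‖ := φ.le_opNorm _
        _ ≤ 1 * ‖d - c‖ := by gcongr
        _ ≤ M := by simpa using hd
    linarith
  have h2 : ‖s b - s a - (b - a) • c‖ = φ (s b - s a - (b - a) • c) := by simpa using hφv.symm
  rw [h2]
  simp only [map_sub, map_smul, smul_eq_mul]
  nlinarith

end AbsolutelyContinuous

/-! ### Quadratic growth and radial unboundedness -/

section Homogeneous

variable {E : Type*} [NormedAddCommGroup E] [NormedSpace ℝ E] [FiniteDimensional ℝ E]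

/-- A continuous positive definite function that is homogeneous of degree two dominates a positive
multiple of the squared norm. -/
theorem exists_mul_norm_sq_le_of_homogeneous {V : E → ℝ} (hV : Continuous V)
    (hom : ∀ (c : ℝ) v, V (c • v) = c ^ 2 * V v) (hpos : ∀ v, v ≠ 0 → 0 < V v) :
    ∃ c > 0, ∀ v, c * ‖v‖ ^ 2 ≤ V v := by
  have := FiniteDimensional.proper_real E
  have h0 : V 0 = 0 := by simpa using hom 0 0
  obtain hE | hE := subsingleton_or_nontrivial E
  · exact ⟨1, one_pos, fun v => by simp [Subsingleton.elim v 0, h0]⟩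
  obtain ⟨w, hw, hmin⟩ := (isCompact_sphere (0 : E) 1).exists_isMinOn
    (NormedSpace.sphere_nonempty.2 zero_le_one) hV.continuousOn
  have hw1 : ‖w‖ = 1 := by simpa using hw
  refine ⟨V w, hpos w (by rintro rfl; simp at hw1), fun v => ?_⟩
  by_cases hv : v = 0
  · simp [hv, h0]
  have hn : ‖v‖ ≠ 0 := norm_ne_zero_iff.2 hv
  have h1 : V w ≤ V (‖v‖⁻¹ • v) := hmin (by simp [norm_smul, hn])
  rw [hom] at h1
  have h2 : (0 : ℝ) < ‖v‖ ^ 2 := by positivity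
  calc V w * ‖v‖ ^ 2 ≤ (‖v‖⁻¹ ^ 2 * V v) * ‖v‖ ^ 2 := by gcongr
    _ = V v := by field

theorem tendsto_cocompact_atTop_of_mul_norm_sq_le {V : E → ℝ} {c : ℝ} (hc : 0 < c) (e : E)
    (h : ∀ v, c * ‖v - e‖ ^ 2 ≤ V v) : Tendsto V (cocompact E) atTop := by
  have := FiniteDimensional.proper_real E
  have h1 : Tendsto (fun v : E => ‖v - e‖) (cocompact E) atTop := by
    simpa [dist_eq_norm] using tendsto_dist_right_cocompact_atTop e
  exact tendsto_atTop_mono h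
    (((tendsto_pow_atTop two_ne_zero).comp h1).const_mul_atTop hc)

end Homogeneous

/-! ### Continuity of monotone operators and of convex gradients -/

section Monotone

variable {E : Type*} [NormedAddCommGroup E] [InnerProductSpace ℝ E]

/-- A monotone operator is continuous at a point where it has no other monotone extension. -/
theorem GNESeeking.IsMonotoneOp.continuousAt [FiniteDimensional ℝ E] {F : E → E}
    (hF : IsMonotoneOp F) {x₀ : E}
    (hmax : ∀ v, (∀ y, 0 ≤ ⟪y - x₀, F y - v⟫) → v = F x₀) : ContinuousAt F x₀ := by
  have := FiniteDimensional.proper_real E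
  rw [ContinuousAt, tendsto_iff_ultrafilter]
  intro U hU
  have hU : Tendsto id (U : Filter E) (𝓝 x₀) := hU
  -- Local boundedness of `F` is not known, so the values are rescaled: the pair `(a F, a)` stays in
  -- a compact set and has a limit `(v, α)` along the ultrafilter.
  set a : E → ℝ := fun x => (1 + ‖F x‖)⁻¹ with ha
  have hpos : ∀ x, 0 < 1 + ‖F x‖ := fun x => by positivity
  have hcpt : ∀ x, (a x • F x, a x) ∈ Metric.closedBall (0 : E) 1 ×ˢ Icc (0 : ℝ) 1 := fun x => by
    have hp := hpos x
    refine ⟨?_, by positivity, inv_le_one_of_one_le₀ (by linarith [norm_nonneg (F x)])⟩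
    rw [mem_closedBall_zero_iff, norm_smul, ha, norm_inv, Real.norm_of_nonneg hp.le,
      inv_mul_le_one₀ hp]
    linarith
  obtain ⟨⟨v, α⟩, -, hlim⟩ :=
    ((isCompact_closedBall (0 : E) 1).prod
      (isCompact_Icc (a := (0 : ℝ)) (b := 1))).ultrafilter_le_nhds (U.map fun x => (a x • F x, a x)) (by
        rw [Ultrafilter.coe_map, le_principal_iff]
        exact Filter.mem_map.2 (Filter.univ_mem' hcpt))
  have hlim : Tendsto (fun x => (a x • F x, a x)) (U : Filter E) (𝓝 (v, α)) := hlim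
  rw [nhds_prod_eq, tendsto_prod_iff'] at hlim
  obtain ⟨hv, hα⟩ := hlim
  have hsum : ‖v‖ + α = 1 := by
    refine tendsto_nhds_unique (hv.norm.add hα) ?_
    refine tendsto_const_nhds.congr fun x => ?_
    have hp := hpos x
    rw [norm_smul, ha, norm_inv, Real.norm_of_nonneg hp.le]
    field
  have hmono : ∀ y, 0 ≤ ⟪y - x₀, α • F y - v⟫ := fun y => by
    refine ge_of_tendsto' ((tendsto_const_nhds.sub hU).inner
      ((hα.smul_const (F y)).sub hv)) fun x => ?_
    rw [← smul_sub, inner_smul_right]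
    exact mul_nonneg (by have := hpos x; positivity) (hF y x)
  have hα0 : 0 ≤ α := ge_of_tendsto' hα fun x => by have := hpos x; positivity
  -- `α = 0` means that `F` blows up along the ultrafilter. Then `‖v‖ = 1`, and `hmono` at `y = x₀ +
  -- v` gives `-‖v‖² ≥ 0`.
  have hαne : α ≠ 0 := by
    rintro rfl
    have h1 := hmono (x₀ + v)
    simp only [add_sub_cancel_left, zero_smul, zero_sub, inner_neg_right,
      real_inner_self_eq_norm_sq] at h1
    nlinarith
  have h2 : Tendsto (fun x => (a x)⁻¹ • (a x • F x)) (U : Filter E) (𝓝 (α⁻¹ • v)) :=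
    (hα.inv₀ hαne).smul hv
  have h3 : α⁻¹ • v = F x₀ := hmax _ fun y => by
    have h4 : F y - α⁻¹ • v = α⁻¹ • (α • F y - v) := by
      rw [smul_sub, inv_smul_smul₀ hαne]
    rw [h4, inner_smul_right]
    exact mul_nonneg (by positivity) (hmono y)
  rw [← h3]
  refine h2.congr fun x => ?_
  rw [inv_smul_smul₀]
  exact inv_ne_zero (hpos x).ne'

theorem ConvexOn.fderiv_le_sub {G : Type*} [NormedAddCommGroup G] [NormedSpace ℝ G] {f : G → ℝ}
    (hf : ConvexOn ℝ univ f) {x : G} (hd : DifferentiableAt ℝ f x) (y : G) :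
    fderiv ℝ f x (y - x) ≤ f y - f x := by
  have hline : HasDerivAt (fun t : ℝ => f (AffineMap.lineMap x y t)) (fderiv ℝ f x (y - x)) 0 := by
    have h1 : HasFDerivAt f (fderiv ℝ f x) (AffineMap.lineMap x y (0 : ℝ)) := by
      simpa using hd.hasFDerivAt
    exact h1.comp_hasDerivAt (0 : ℝ) AffineMap.hasDerivAt_lineMap
  have hconv : ConvexOn ℝ univ (fun t : ℝ => f (AffineMap.lineMap x y t)) :=
    hf.comp_affineMap (AffineMap.lineMap x y : ℝ →ᵃ[ℝ] G)
  have := hconv.le_slope_of_hasDerivAt (mem_univ 0) (mem_univ 1) one_pos hline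
  simpa [slope_def_field] using this

variable [CompleteSpace E]

theorem ConvexOn.inner_gradient_le_sub {f : E → ℝ} (hf : ConvexOn ℝ univ f) {x : E}
    (hd : DifferentiableAt ℝ f x) (y : E) : ⟪gradient f x, y - x⟫ ≤ f y - f x := by
  simpa [gradient] using hf.fderiv_le_sub hd y

theorem ConvexOn.isMonotoneOp_gradient {f : E → ℝ} (hf : ConvexOn ℝ univ f)
    (hd : Differentiable ℝ f) : IsMonotoneOp (gradient f) := fun x y => by
  have h1 := hf.inner_gradient_le_sub (hd x) y
  have h2 := hf.inner_gradient_le_sub (hd y) x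
  rw [real_inner_comm] at h1 h2
  rw [← neg_sub x y, inner_neg_left] at h1
  rw [inner_sub_right]
  linarith

/-- The gradient of a differentiable function admits no proper monotone extension at a point. -/
theorem eq_gradient_of_forall_inner_nonneg {f : E → ℝ} (hd : Differentiable ℝ f) {x₀ v : E}
    (h : ∀ y, 0 ≤ ⟪y - x₀, gradient f y - v⟫) : v = gradient f x₀ := by
  -- By the mean value theorem on the segment from `x₀` to `y`, the hypothesis makes `x₀` a global
  -- minimizer of `f - ⟪v, ·⟫`; its first-order condition is the claim.
  have hmin : ∀ y, f x₀ - ⟪v, x₀⟫ ≤ f y - ⟪v, y⟫ := fun y => by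
    have hline : ∀ t : ℝ, HasDerivAt (fun t : ℝ => f (x₀ + t • (y - x₀)))
        (fderiv ℝ f (x₀ + t • (y - x₀)) (y - x₀)) t := fun t => by
      have h1 : HasDerivAt (fun t : ℝ => x₀ + t • (y - x₀)) (y - x₀) t := by
        simpa using ((hasDerivAt_id t).smul_const (y - x₀)).const_add x₀
      exact (hd _).hasFDerivAt.comp_hasDerivAt t h1
    obtain ⟨t, ⟨ht0, ht1⟩, hzeq⟩ := exists_hasDerivAt_eq_slope _ _ zero_lt_one
      (fun t _ => (hline t).continuousAt.continuousWithinAt) fun t _ => hline t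
    simp only [one_smul, zero_smul, add_zero, add_sub_cancel, sub_zero, div_one] at hzeq
    have h1 := h (x₀ + t • (y - x₀))
    rw [add_sub_cancel_left, inner_smul_left, inner_sub_right] at h1
    have h2 : ⟪y - x₀, gradient f (x₀ + t • (y - x₀))⟫ =
        fderiv ℝ f (x₀ + t • (y - x₀)) (y - x₀) := by
      rw [real_inner_comm]; simp [gradient]
    have h3 := nonneg_of_mul_nonneg_right h1 (by simpa using ht0)
    rw [h2, hzeq, real_inner_comm, inner_sub_right] at h3
    linarith
  have hloc : IsLocalMin (fun y => f y - ⟪v, y⟫) x₀ := Filter.Eventually.of_forall hmin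
  have hder : HasFDerivAt (fun y => f y - ⟪v, y⟫) (fderiv ℝ f x₀ - innerSL ℝ v) x₀ :=
    (hd x₀).hasFDerivAt.sub (innerSL ℝ v).hasFDerivAt
  have h0 := hloc.hasFDerivAt_eq_zero hder
  rw [sub_eq_zero] at h0
  refine ext_inner_right ℝ fun w => ?_
  have := congrArg (fun φ => φ w) h0
  simp [gradient] at this ⊢
  exact this.symm

theorem ConvexOn.continuous_gradient [FiniteDimensional ℝ E] {f : E → ℝ} (hf : ConvexOn ℝ univ f)
    (hd : Differentiable ℝ f) : Continuous (gradient f) :=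
  continuous_iff_continuousAt.2 fun _ => (hf.isMonotoneOp_gradient hd).continuousAt
    fun _ hv => eq_gradient_of_forall_inner_nonneg hd hv

end Monotone

/-! ### An invariance principle for discontinuous vector fields -/

section Invariance

variable {E G : Type*} [NormedAddCommGroup E] [NormedSpace ℝ E]
  [NormedAddCommGroup G] [NormedSpace ℝ G]

/-- Locally absolutely continuous solutions on `[0, ∞)`, with values in `D`, of the differential
equation `s' = f s`. -/
structure IsCaratheodorySolution (f : E → E) (D : Set E) (s : ℝ → E) : Prop where
  mem : ∀ t, 0 ≤ t → s t ∈ D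
  absolutelyContinuous : ∀ T, 0 ≤ T → AbsolutelyContinuousOnInterval s 0 T
  hasDerivAt : ∀ᵐ t ∂volume, 0 < t → HasDerivAt s (f (s t)) t

namespace IsCaratheodorySolution

variable {f : E → E} {D : Set E} {s : ℝ → E}

theorem absolutelyContinuousOnInterval (hs : IsCaratheodorySolution f D s) {a b : ℝ}
    (ha : 0 ≤ a) (hab : a ≤ b) :
    AbsolutelyContinuousOnInterval s a b := by
  refine (hs.absolutelyContinuous b (ha.trans hab)).mono ?_
  rw [uIcc_of_le hab, uIcc_of_le (ha.trans hab)]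
  exact Icc_subset_Icc_left ha

theorem sub_le_of_fderiv_le [FiniteDimensional ℝ E] (hs : IsCaratheodorySolution f D s)
    {V : E → ℝ} (hV : ContDiff ℝ 1 V) {a b κ : ℝ}
    (ha : 0 ≤ a) (hab : a ≤ b) (h : ∀ t ∈ Ioc a b, fderiv ℝ V (s t) (f (s t)) ≤ κ) :
    V (s b) - V (s a) ≤ κ * (b - a) := by
  refine ((hs.absolutelyContinuousOnInterval ha hab).contDiff_comp hV).sub_le_of_ae_deriv_le
    hab ?_
  filter_upwards [hs.hasDerivAt] with t ht hmem
  refine ⟨_, h t hmem, ?_⟩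
  exact ((hV.differentiable one_ne_zero) (s t)).hasFDerivAt.comp_hasDerivAt t
    (ht (ha.trans_lt hmem.1))

theorem norm_comp_sub_sub_le [FiniteDimensional ℝ E] (hs : IsCaratheodorySolution f D s)
    (C : E →L[ℝ] G) {a b M : ℝ} {c : G}
    (ha : 0 ≤ a) (hb : 0 ≤ b) (h : ∀ t ∈ uIcc a b, ‖C (f (s t)) - c‖ ≤ M) :
    ‖C (s b) - C (s a) - (b - a) • c‖ ≤ M * |b - a| := by
  wlog hab : a ≤ b generalizing a b
  · have h1 := this hb ha (by rwa [uIcc_comm]) (not_le.1 hab).le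
    have h2 : C (s b) - C (s a) - (b - a) • c = -(C (s a) - C (s b) - (a - b) • c) := by
      rw [sub_smul, sub_smul]
      abel
    rwa [h2, norm_neg, abs_sub_comm]
  rw [abs_of_nonneg (sub_nonneg.2 hab)]
  refine AbsolutelyContinuousOnInterval.norm_sub_sub_le hab
    (C.lipschitz.lipschitzOnWith.comp_absolutelyContinuousOnInterval (mapsTo_univ _ _)
      (hs.absolutelyContinuousOnInterval ha hab)) ?_
  filter_upwards [hs.hasDerivAt] with t ht hmem
  exact ⟨_, h t (by rw [uIcc_of_le hab]; exact Ioc_subset_Icc_self hmem),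
    C.hasFDerivAt.comp_hasDerivAt t (ht (ha.trans_lt hmem.1))⟩

end IsCaratheodorySolution

/-- An invariance principle. Every equilibrium `e` has a Lyapunov function `V e` that decays at
least at the rate `φ`, the part `C s` of the state obeys a linear equation, this linear equation
has only constant solutions on which `φ` vanishes, and points at which the vector field is not
bounded away from zero in any direction are equilibria. Then every solution converges to an
equilibrium. -/
theorem IsCaratheodorySolution.exists_tendsto_equilibrium [FiniteDimensional ℝ E]
    {f : E → E} {D : Set E} {s : ℝ → E} (hs : IsCaratheodorySolution f D s) (hD : IsClosed D)
    (hbdd : ∀ R, ∃ K, ∀ x ∈ D, ‖x‖ ≤ R → ‖f x‖ ≤ K)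
    {S : Set E} (hne : S.Nonempty) {V : E → E → ℝ} {φ : E → ℝ} {c : ℝ} (hc : 0 < c)
    (hVd : ∀ e ∈ S, ContDiff ℝ 1 (V e)) (hV0 : ∀ e ∈ S, V e e = 0)
    (hVc : ∀ e ∈ S, ∀ x, c * ‖x - e‖ ^ 2 ≤ V e x)
    (hdiss : ∀ e ∈ S, ∀ x ∈ D, fderiv ℝ (V e) x (f x) ≤ -φ x)
    (hφ : Continuous φ) (hφ0 : ∀ x, 0 ≤ φ x)
    (C A : E →L[ℝ] G) (hCA : ∀ x ∈ D, C (f x) = A x)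
    (hconst : ∀ σ : ℝ → E, Continuous σ → (∀ τ, φ (σ τ) = 0) →
      (∀ τ, HasDerivAt (fun t => C (σ t)) (A (σ τ)) τ) → ∀ τ, σ τ = σ 0)
    (hstat : ∀ x ∈ D, (∀ (l : E →L[ℝ] ℝ) (r : ℝ), (∀ᶠ y in 𝓝[D] x, r ≤ l (f y)) → r ≤ 0) →
      x ∈ S) :
    ∃ e ∈ S, Tendsto s atTop (𝓝 e) := by
  have := FiniteDimensional.proper_real E
  have decay : ∀ e ∈ S, ∀ a b κ : ℝ, 0 ≤ a → a ≤ b → (∀ t ∈ Ioc a b, κ ≤ φ (s t)) →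
      V e (s b) - V e (s a) ≤ -κ * (b - a) := fun e he a b κ ha hab h =>
    hs.sub_le_of_fderiv_le (hVd e he) ha hab fun t ht =>
      (hdiss e he _ (hs.mem t (ha.trans ht.1.le))).trans (neg_le_neg (h t ht))
  have anti : ∀ e ∈ S, ∀ a b : ℝ, 0 ≤ a → a ≤ b → V e (s b) ≤ V e (s a) :=
    fun e he a b ha hab => by
      have := decay e he a b 0 ha hab fun t _ => hφ0 _
      linarith
  have hVnn : ∀ e ∈ S, ∀ x, 0 ≤ V e x := fun e he x =>
    le_trans (by positivity) (hVc e he x)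
  obtain ⟨e₀, he₀⟩ := hne
  obtain ⟨R, hR⟩ : ∃ R, ∀ t, 0 ≤ t → ‖s t‖ ≤ R := by
    -- The sublevel set of `V e₀` through `s 0` is bounded by the quadratic lower bound.
    refine ⟨‖e₀‖ + √(V e₀ (s 0) / c), fun t ht => ?_⟩
    have h1 : ‖s t - e₀‖ ^ 2 ≤ V e₀ (s 0) / c := by
      rw [le_div_iff₀' hc]
      exact (hVc e₀ he₀ _).trans (anti e₀ he₀ 0 t le_rfl ht)
    have h2 := Real.le_sqrt_of_sq_le h1
    have h3 := norm_add_le e₀ (s t - e₀)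
    rw [add_sub_cancel] at h3
    linarith
  obtain ⟨K, hK⟩ := hbdd R
  have hK0 : 0 ≤ K := (norm_nonneg _).trans (hK _ (hs.mem 0 le_rfl) (hR 0 le_rfl))
  have hlip : ∀ a b : ℝ, 0 ≤ a → 0 ≤ b → ‖s b - s a‖ ≤ K * |b - a| := fun a b ha hb => by
    have := hs.norm_comp_sub_sub_le (ContinuousLinearMap.id ℝ E) (c := 0) (M := K) ha hb
      fun t ht => by
        have ht0 : 0 ≤ t := (le_inf ha hb).trans ht.1
        simpa using hK _ (hs.mem t ht0) (hR t ht0)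
    simpa using this
  -- limits of the shifted solution along an ultrafilter
  set U : Ultrafilter ℝ := Ultrafilter.of atTop
  have hU : (U : Filter ℝ) ≤ atTop := Ultrafilter.of_le atTop
  have hev : ∀ τ : ℝ, ∀ᶠ t in (U : Filter ℝ), 0 ≤ t + τ := fun τ => by
    filter_upwards [hU (eventually_ge_atTop (-τ))] with t ht
    linarith
  have hexists : ∀ τ : ℝ, ∃ p, Tendsto (fun t => s (t + τ)) (U : Filter ℝ) (𝓝 p) := fun τ => by
    obtain ⟨p, -, hp⟩ := (isCompact_closedBall (0 : E) R).ultrafilter_le_nhds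
      (U.map fun t => s (t + τ)) (by
        rw [Ultrafilter.coe_map, le_principal_iff]
        refine Filter.mem_map.2 ?_
        filter_upwards [hev τ] with t ht
        simpa using hR _ ht)
    exact ⟨p, hp⟩
  choose σ hσ using hexists
  have hσD : ∀ τ, σ τ ∈ D := fun τ => hD.mem_of_tendsto (hσ τ) <| by
    filter_upwards [hev τ] with t ht using hs.mem _ ht
  have hσlip : ∀ a b : ℝ, ‖σ b - σ a‖ ≤ K * |b - a| := fun a b => by
    refine le_of_tendsto ((hσ b).sub (hσ a)).norm ?_
    filter_upwards [hev a, hev b] with t ha hb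
    simpa using hlip _ _ ha hb
  have hσcont : Continuous σ := by
    refine LipschitzWith.continuous (K := ⟨K, hK0⟩) (LipschitzWith.of_dist_le_mul fun a b => ?_)
    rw [dist_eq_norm, Real.dist_eq]
    exact hσlip b a
  -- Otherwise `φ` exceeds half its value at `σ τ` during a window of fixed length `h` after `t +
  -- τ`, for ultrafilter-many `t`, so `V e₀` drops there by a fixed amount. But `V e₀` converges
  -- along the trajectory.
  have hφσ : ∀ τ, φ (σ τ) = 0 := fun τ => by
    by_contra hne
    have hpos : 0 < φ (σ τ) := lt_of_le_of_ne (hφ0 _) (Ne.symm hne)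
    obtain ⟨ρ, hρ, hball⟩ := Metric.eventually_nhds_iff_ball.1
      (hφ.continuousAt.eventually (lt_mem_nhds (half_lt_self hpos)))
    -- The speed is at most `K`, so a trajectory within `ρ / 2` of `σ τ` stays in the `ρ`-ball for
    -- time `h`.
    obtain ⟨h, hh, hKh⟩ : ∃ h : ℝ, 0 < h ∧ K * h < ρ / 2 := by
      refine ⟨ρ / 2 / (K + 1), by positivity, ?_⟩
      rw [mul_div_assoc', div_lt_iff₀ (by positivity)]
      nlinarith
    obtain ⟨v, hv⟩ : ∃ v, Tendsto (fun t => V e₀ (s t)) atTop (𝓝 v) := by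
      have hanti : Antitone fun t : ℝ => V e₀ (s (max t 0)) := fun a b hab =>
        anti e₀ he₀ _ _ (le_max_right _ _) (max_le_max_right _ hab)
      refine ⟨_, (tendsto_atTop_ciInf hanti ⟨0, ?_⟩).congr' ?_⟩
      · rintro _ ⟨t, rfl⟩
        exact hVnn e₀ he₀ _
      · filter_upwards [eventually_ge_atTop 0] with t ht
        rw [max_eq_left ht]
    have hshift : ∀ r : ℝ, Tendsto (fun t => V e₀ (s (t + r))) (U : Filter ℝ) (𝓝 v) := fun r =>
      (hv.comp (tendsto_atTop_add_const_right atTop r tendsto_id)).mono_left hU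
    have hle : v - v ≤ -(φ (σ τ) / 2) * h := by
      refine le_of_tendsto ((hshift (τ + h)).sub (hshift τ)) ?_
      filter_upwards [hev τ, (hσ τ).eventually (Metric.ball_mem_nhds _ (half_pos hρ))]
        with t ht hball'
      have := decay e₀ he₀ (t + τ) (t + (τ + h)) (φ (σ τ) / 2) ht (by linarith) fun r hr => ?_
      · exact this.trans_eq (by ring)
      · refine (hball _ ?_).le
        rw [dist_eq_norm] at hball'
        rw [Metric.mem_ball, dist_eq_norm]
        have h1 := hlip (t + τ) r ht (ht.trans hr.1.le)
        have h2 : K * |r - (t + τ)| ≤ K * h := by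
          refine mul_le_mul_of_nonneg_left ?_ hK0
          rw [abs_of_nonneg (by linarith [hr.1])]
          linarith [hr.2]
        calc ‖s r - σ τ‖ = ‖(s r - s (t + τ)) + (s (t + τ) - σ τ)‖ := by rw [sub_add_sub_cancel]
          _ ≤ _ := norm_add_le _ _
          _ < ρ := by linarith
    nlinarith
  have hσderiv : ∀ τ, HasDerivAt (fun t => C (σ t)) (A (σ τ)) τ := fun τ => by
    -- A Taylor estimate with constants independent of the shift passes to the limit. It uses only
    -- that `A` is Lipschitz along the trajectory, so `f` itself need not be continuous.
    have hquad : ∀ τ', ‖C (σ τ') - C (σ τ) - (τ' - τ) • A (σ τ)‖ ≤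
        (‖A‖ * K) * |τ' - τ| * |τ' - τ| := fun τ' => by
      refine le_of_tendsto (((((C.continuous.tendsto _).comp (hσ τ')).sub
        ((C.continuous.tendsto _).comp (hσ τ))).sub
        (((A.continuous.tendsto _).comp (hσ τ)).const_smul (τ' - τ))).norm) ?_
      filter_upwards [hev τ, hev τ'] with t h1 h2
      have := hs.norm_comp_sub_sub_le C (a := t + τ) (b := t + τ') (c := A (s (t + τ)))
        (M := (‖A‖ * K) * |τ' - τ|) h1 h2 fun r hr => by
          have hr0 : 0 ≤ r := (le_inf h1 h2).trans hr.1
          rw [hCA _ (hs.mem r hr0), ← map_sub, mul_assoc]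
          refine (A.le_opNorm _).trans (mul_le_mul_of_nonneg_left ?_ (norm_nonneg _))
          refine (hlip _ _ h1 hr0).trans (mul_le_mul_of_nonneg_left ?_ hK0)
          simpa using abs_sub_left_of_mem_uIcc hr
      simpa using this
    rw [hasDerivAt_iff_isLittleO]
    refine Asymptotics.IsBigO.trans_isLittleO (g := fun τ' => (τ' - τ) * (τ' - τ)) ?_ ?_
    · refine Asymptotics.IsBigO.of_bound (‖A‖ * K) (Filter.Eventually.of_forall fun τ' => ?_)
      simpa [mul_assoc] using hquad τ'
    · have h0 : Tendsto (fun τ' : ℝ => τ' - τ) (𝓝 τ) (𝓝 0) := by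
        simpa using (tendsto_id (α := ℝ) (x := 𝓝 τ)).sub_const τ
      simpa using ((Asymptotics.isLittleO_one_iff ℝ).2 h0).mul_isBigO
        (Asymptotics.isBigO_refl (fun τ' : ℝ => τ' - τ) (𝓝 τ))
  have hσconst := hconst σ hσcont hφσ hσderiv
  -- If `l ∘ f ≥ r > 0` on `D` near `σ 0`, then `l (s ·)` gains at least `r h` over a short window,
  -- whereas its limiting gain is `l (σ h) - l (σ 0) = 0`.
  have hstate : σ 0 ∈ S := by
    refine hstat _ (hσD 0) fun l r hlr => ?_
    obtain ⟨ρ, hρ, hball⟩ := Metric.mem_nhdsWithin_iff.1 hlr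
    obtain ⟨h, hh, hKh⟩ : ∃ h : ℝ, 0 < h ∧ K * h < ρ / 2 := by
      refine ⟨ρ / 2 / (K + 1), by positivity, ?_⟩
      rw [mul_div_assoc', div_lt_iff₀ (by positivity)]
      nlinarith
    have hlim : Tendsto (fun t => (-l) (s (t + h)) - (-l) (s (t + 0))) (U : Filter ℝ)
        (𝓝 ((-l) (σ h) - (-l) (σ 0))) :=
      (((-l).continuous.tendsto _).comp (hσ h)).sub (((-l).continuous.tendsto _).comp (hσ 0))
    rw [hσconst h, sub_self] at hlim
    have hle : 0 ≤ -r * h := by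
      refine le_of_tendsto hlim ?_
      filter_upwards [hev 0, (hσ 0).eventually (Metric.ball_mem_nhds _ (half_pos hρ))]
        with t ht hball'
      have := hs.sub_le_of_fderiv_le (V := fun x => (-l) x) (-l).contDiff (a := t + 0) (b := t + h)
        (κ := -r) ht (by linarith) fun τ hτ => ?_
      · exact this.trans_eq (by ring)
      · rw [ContinuousLinearMap.fderiv]
        have : r ≤ l (f (s τ)) := hball ⟨?_, hs.mem τ (ht.trans hτ.1.le)⟩
        · simpa using this
        rw [dist_eq_norm] at hball'
        rw [Metric.mem_ball, dist_eq_norm]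
        have h1 := hlip (t + 0) τ ht (ht.trans hτ.1.le)
        have h2 : K * |τ - (t + 0)| ≤ K * h := by
          refine mul_le_mul_of_nonneg_left ?_ hK0
          rw [abs_of_nonneg (by linarith [hτ.1])]
          linarith [hτ.2]
        calc ‖s τ - σ 0‖ = ‖(s τ - s (t + 0)) + (s (t + 0) - σ 0)‖ := by rw [sub_add_sub_cancel]
          _ ≤ _ := norm_add_le _ _
          _ < ρ := by linarith
    by_contra hr
    nlinarith [not_le.1 hr]
  refine ⟨σ 0, hstate, ?_⟩
  -- The limit is zero along the ultrafilter; monotonicity in time upgrades this to `atTop`.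
  have hVlim : Tendsto (fun t => V (σ 0) (s t)) atTop (𝓝 0) := by
    have hUlim : Tendsto (fun t => V (σ 0) (s (t + 0))) (U : Filter ℝ) (𝓝 0) := by
      have := ((hVd _ hstate).continuous.tendsto _).comp (hσ 0)
      rwa [hV0 _ hstate] at this
    rw [Metric.tendsto_atTop]
    intro ε hε
    obtain ⟨T, hT, hT0⟩ := ((hUlim.eventually (gt_mem_nhds hε)).and (hev 0)).exists
    rw [add_zero] at hT hT0
    refine ⟨T, fun t ht => ?_⟩
    rw [dist_zero_right, Real.norm_of_nonneg (hVnn _ hstate _)]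
    exact (anti _ hstate T t hT0 ht).trans_lt hT
  rw [tendsto_iff_norm_sub_tendsto_zero]
  have hsq : Tendsto (fun t => √(V (σ 0) (s t) / c)) atTop (𝓝 0) := by
    simpa using (hVlim.div_const c).sqrt
  refine squeeze_zero (fun t => norm_nonneg _) (fun t => ?_) hsq
  refine Real.le_sqrt_of_sq_le ?_
  rw [le_div_iff₀' hc]
  exact hVc _ hstate _

end Invariance

namespace GNESeeking

/-! ### Quadratic storage functions -/

section Storage

variable {p : ℕ} {P : Matrix (Fin p) (Fin p) ℝ}

theorem contDiff_quadStorage (P : Matrix (Fin p) (Fin p) ℝ) : ContDiff ℝ 1 (quadStorage P) := by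
  unfold quadStorage
  simp only [dotProduct, Matrix.mulVec]
  fun_prop

theorem quadStorage_smul (P : Matrix (Fin p) (Fin p) ℝ) (c : ℝ) (ξ : Vec p) :
    quadStorage P (c • ξ) = c ^ 2 * quadStorage P ξ := by
  simp only [quadStorage, WithLp.ofLp_smul, Matrix.mulVec_smul, dotProduct_smul, smul_dotProduct,
    smul_eq_mul]
  ring

theorem quadStorage_zero (P : Matrix (Fin p) (Fin p) ℝ) : quadStorage P 0 = 0 := by
  simp [quadStorage]

theorem quadStorage_pos (hP : P.PosDef) {ξ : Vec p} (hξ : ξ ≠ 0) : 0 < quadStorage P ξ := by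
  have h0 : ξ.ofLp ≠ 0 := fun h => hξ (by ext i; simp [h])
  have := hP.dotProduct_mulVec_pos h0
  rw [star_trivial] at this
  unfold quadStorage
  positivity

end Storage

/-! ### A single compensator -/

namespace LTI

variable {p q : ℕ} (H : LTI p q)

theorem field_eq (ξ : Vec p) (u : Vec q) :
    H.field ξ u = Matrix.toEuclideanLin H.A ξ + Matrix.toEuclideanLin H.B u := rfl

theorem out_eq (ξ : Vec p) (u : Vec q) :
    H.out ξ u = Matrix.toEuclideanLin H.C ξ + Matrix.toEuclideanLin H.D u := rfl

/-- The output vanishes at every equilibrium when the transfer function vanishes at zero. -/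
theorem out_eq_zero_of_field_eq_zero {H : LTI p q} (hA : IsUnit H.A) (hT : H.transfer 0 = 0)
    {ξ : Vec p} {u : Vec q} (h : H.field ξ u = 0) : H.out ξ u = 0 := by
  have hdet : IsUnit H.A.det := (Matrix.isUnit_iff_isUnit_det _).1 hA
  have hinv : ((0 : ℂ) • (1 : Matrix (Fin p) (Fin p) ℂ) - H.A.map Complex.ofReal)⁻¹ =
      (-H.A⁻¹).map Complex.ofRealHom := by
    refine Matrix.inv_eq_right_inv ?_
    have : (0 : ℂ) • (1 : Matrix (Fin p) (Fin p) ℂ) - H.A.map Complex.ofReal =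
        (-H.A).map Complex.ofRealHom := by
      ext i j; simp
    rw [this, ← Matrix.map_mul, neg_mul_neg, Matrix.mul_nonsing_inv _ hdet]
    exact Matrix.map_one _ (map_zero _) (map_one _)
  -- This is the transfer function at zero, brought back from complex to real entries.
  have hD : H.C * -H.A⁻¹ * H.B + H.D = 0 := by
    have h1 : (H.C * -H.A⁻¹ * H.B + H.D).map Complex.ofRealHom = 0 := by
      rw [Matrix.map_add _ (map_add _), Matrix.map_mul, Matrix.map_mul, ← hinv]
      exact hT
    ext i j
    exact Complex.ofReal_eq_zero.1 (congrFun (congrFun h1 i) j)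
  have h0 : H.A.mulVec ξ.ofLp + H.B.mulVec u.ofLp = 0 := congrArg WithLp.ofLp h
  have hξ : ξ.ofLp = (-H.A⁻¹).mulVec (H.B.mulVec u.ofLp) := by
    rw [← neg_eq_of_add_eq_zero_right h0, Matrix.neg_mulVec, Matrix.mulVec_neg, neg_neg,
      Matrix.mulVec_mulVec, Matrix.nonsing_inv_mul _ hdet, Matrix.one_mulVec]
  unfold out
  rw [hξ, Matrix.mulVec_mulVec, Matrix.mulVec_mulVec, ← Matrix.add_mulVec, hD]
  simp

/-- On the whole real line, zero output forces both state and input to be constant. -/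
theorem IsCompensator.const_of_out_eq_zero {H : LTI p q} {P : Matrix (Fin p) (Fin p) ℝ}
    (hH : H.IsCompensator P) {ξ : ℝ → Vec p} {u : ℝ → Vec q} (hu : Continuous u)
    (hξ : ∀ t, HasDerivAt ξ (H.field (ξ t) (u t)) t) (hout : ∀ t, H.out (ξ t) (u t) = 0) (t : ℝ) :
    ξ t = ξ 0 ∧ u t = u 0 := by
  -- The hypothesis concerns `[0, ∞)` only; starting it at an arbitrary time `a` covers negative
  -- times too.
  have hforward : ∀ a r, 0 ≤ r → ξ (r + a) = ξ a := fun a r hr => by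
    have := hH.zeroOutput (fun r => u (r + a)) (fun r => ξ (r + a))
      (hu.comp (continuous_add_const a)).continuousOn
      (fun r _ => ((hξ (r + a)).comp_add_const r a).hasDerivWithinAt) (fun r _ => hout _) r hr
    simpa using this
  have hconst : ∀ t, ξ t = ξ 0 := fun t => by
    rcases le_total 0 t with ht | ht
    · simpa using hforward 0 t ht
    · simpa using (hforward t (-t) (neg_nonneg.2 ht)).symm
  refine ⟨hconst t, ?_⟩
  have hfield : ∀ t, H.field (ξ 0) (u t) = 0 := fun t => by
    rw [← hconst t]
    refine (hξ t).unique ?_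
    have : ξ = fun _ => ξ 0 := funext hconst
    rw [this]
    exact hasDerivAt_const t _
  -- Full column rank: with the state frozen, the state equation determines the input.
  have hB : Function.Injective (Matrix.toEuclideanLin H.B) := by
    have hrank : Module.finrank ℝ (LinearMap.range H.B.mulVecLin) = q := hH.rank_B
    have hker := LinearMap.finrank_range_add_finrank_ker H.B.mulVecLin
    rw [hrank, Module.finrank_fin_fun, Nat.add_eq_left, Submodule.finrank_eq_zero] at hker
    have hinj := LinearMap.ker_eq_bot.1 hker
    intro v w hvw
    exact (WithLp.ofLp_injective 2) (hinj (congrArg WithLp.ofLp hvw))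
  have h1 := (hfield t).trans (hfield 0).symm
  rw [field_eq, field_eq] at h1
  exact hB (add_left_cancel h1)

end LTI

/-! ### Banks of compensators -/

section Bank

variable {N : ℕ} {p d : Fin N → ℕ}

theorem col_apply (f : ∀ i, Vec (d i)) (i : Fin N) : col f i = f i := rfl

/-- The state equation of a bank of compensators as a linear map. -/
noncomputable def bankFieldCLM (H : ∀ i, LTI (p i) (d i)) :
    (Blocks d × Blocks p) →L[ℝ] Blocks p :=
  LinearMap.toContinuousLinearMap
    { toFun := fun s => bankField H s.2 s.1
      map_add' := fun s t => by
        ext1 i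
        simp only [bankField, col_apply, LTI.field_eq, Prod.fst_add, Prod.snd_add, PiLp.add_apply,
          map_add]
        abel
      map_smul' := fun c s => by
        ext1 i
        simp only [bankField, col_apply, LTI.field_eq, Prod.smul_fst, Prod.smul_snd,
          PiLp.smul_apply, map_smul, smul_add, RingHom.id_apply] }

/-- The output of a bank of compensators as a linear map. -/
noncomputable def bankOutCLM (H : ∀ i, LTI (p i) (d i)) :
    (Blocks d × Blocks p) →L[ℝ] Blocks d :=
  LinearMap.toContinuousLinearMap
    { toFun := fun s => bankOut H s.2 s.1
      map_add' := fun s t => by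
        ext1 i
        simp only [bankOut, col_apply, LTI.out_eq, Prod.fst_add, Prod.snd_add, PiLp.add_apply,
          map_add]
        abel
      map_smul' := fun c s => by
        ext1 i
        simp only [bankOut, col_apply, LTI.out_eq, Prod.smul_fst, Prod.smul_snd,
          PiLp.smul_apply, map_smul, smul_add, RingHom.id_apply] }

theorem bankFieldCLM_apply (H : ∀ i, LTI (p i) (d i)) (s : Blocks d × Blocks p) :
    bankFieldCLM H s = bankField H s.2 s.1 := rfl

theorem bankOutCLM_apply (H : ∀ i, LTI (p i) (d i)) (s : Blocks d × Blocks p) :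
    bankOutCLM H s = bankOut H s.2 s.1 := rfl

variable {H : ∀ i, LTI (p i) (d i)} {P : ∀ i, Matrix (Fin (p i)) (Fin (p i)) ℝ}

theorem bankOut_eq_zero_of_bankField_eq_zero (hH : ∀ i, (H i).IsCompensator (P i)) {ξ : Blocks p}
    {u : Blocks d} (h : bankField H ξ u = 0) : bankOut H ξ u = 0 := by
  ext1 i
  exact LTI.out_eq_zero_of_field_eq_zero (hH i).isUnit_A (hH i).transfer_zero
    (congrArg (fun v : Blocks p => v i) h)

/-- The detectability step of the invariance argument: it freezes the driving signal along with the
compensator states, although no differential equation for that signal is assumed. -/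
theorem const_of_bankOut_eq_zero (hH : ∀ i, (H i).IsCompensator (P i))
    {σ : ℝ → Blocks d × Blocks p} (hσ : Continuous σ)
    (hderiv : ∀ t, HasDerivAt (fun r => (σ r).2) (bankField H (σ t).2 (σ t).1) t)
    (hout : ∀ t, bankOut H (σ t).2 (σ t).1 = 0) (t : ℝ) : σ t = σ 0 := by
  have key : ∀ i, (σ t).2 i = (σ 0).2 i ∧ (σ t).1 i = (σ 0).1 i := fun i =>
    (hH i).const_of_out_eq_zero (ξ := fun r => (σ r).2 i) (u := fun r => (σ r).1 i)
      ((PiLp.continuous_apply 2 _ i).comp hσ.fst)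
      (fun r => (PiLp.proj (𝕜 := ℝ) 2 (fun i => Vec (p i)) i).hasFDerivAt.comp_hasDerivAt r
        (hderiv r))
      (fun r => congrArg (fun v : Blocks d => v i) (hout r)) t
  refine Prod.ext ?_ ?_
  · ext1 i; exact (key i).2
  · ext1 i; exact (key i).1

theorem contDiff_bankStorage (P : ∀ i, Matrix (Fin (p i)) (Fin (p i)) ℝ) :
    ContDiff ℝ 1 (bankStorage P) :=
  ContDiff.sum fun i _ => (contDiff_quadStorage (P i)).comp
    (PiLp.proj (𝕜 := ℝ) 2 (fun i => Vec (p i)) i).contDiff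

theorem bankStorage_smul (P : ∀ i, Matrix (Fin (p i)) (Fin (p i)) ℝ) (c : ℝ) (ξ : Blocks p) :
    bankStorage P (c • ξ) = c ^ 2 * bankStorage P ξ := by
  simp only [bankStorage, PiLp.smul_apply, quadStorage_smul, Finset.mul_sum]

theorem bankStorage_zero (P : ∀ i, Matrix (Fin (p i)) (Fin (p i)) ℝ) : bankStorage P 0 = 0 := by
  simp [bankStorage, quadStorage_zero]

theorem quadStorage_nonneg {p : ℕ} {P : Matrix (Fin p) (Fin p) ℝ} (hP : P.PosDef) (ξ : Vec p) :
    0 ≤ quadStorage P ξ := by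
  by_cases hξ : ξ = 0
  · rw [hξ, quadStorage_zero]
  · exact (quadStorage_pos hP hξ).le

theorem bankStorage_nonneg (hP : ∀ i, (P i).PosDef) (ξ : Blocks p) : 0 ≤ bankStorage P ξ :=
  Finset.sum_nonneg fun i _ => quadStorage_nonneg (hP i) _

theorem bankStorage_pos (hP : ∀ i, (P i).PosDef) {ξ : Blocks p} (hξ : ξ ≠ 0) :
    0 < bankStorage P ξ := by
  obtain ⟨i, hi⟩ : ∃ i, ξ i ≠ 0 := by
    by_contra! h
    exact hξ (by ext1 i; exact h i)
  exact Finset.sum_pos' (fun i _ => quadStorage_nonneg (hP i) _)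
    ⟨i, Finset.mem_univ i, quadStorage_pos (hP i) hi⟩

theorem fderiv_bankStorage_apply (P : ∀ i, Matrix (Fin (p i)) (Fin (p i)) ℝ) (ξ v : Blocks p) :
    fderiv ℝ (bankStorage P) ξ v = ∑ i, fderiv ℝ (quadStorage (P i)) (ξ i) (v i) := by
  have h : HasFDerivAt (bankStorage P) (∑ i, (fderiv ℝ (quadStorage (P i)) (ξ i)).comp
      (PiLp.proj (𝕜 := ℝ) 2 (fun i => Vec (p i)) i)) ξ :=
    HasFDerivAt.fun_sum fun i _ =>
      HasFDerivAt.comp ξ (((contDiff_quadStorage (P i)).differentiable one_ne_zero) _).hasFDerivAt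
        (PiLp.proj (𝕜 := ℝ) 2 (fun i => Vec (p i)) i).hasFDerivAt
  rw [h.fderiv]
  simp

theorem exists_fderiv_bankStorage_le (hH : ∀ i, (H i).OutputStrictlyPassive (P i)) :
    ∃ δ > 0, ∀ ξ u, fderiv ℝ (bankStorage P) ξ (bankField H ξ u) ≤
      ⟪u, bankOut H ξ u⟫ - δ * ‖bankOut H ξ u‖ ^ 2 := by
  choose δ hδ hle using fun i => (hH i).2
  -- A common positive passivity margin; working in `Ioi 0` also covers an empty set of players.
  obtain ⟨⟨δ₀, hδ₀⟩, hmin⟩ := Finite.exists_ge (α := Ioi (0 : ℝ)) fun i => ⟨δ i, hδ i⟩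
  refine ⟨δ₀, hδ₀, fun ξ u => ?_⟩
  rw [fderiv_bankStorage_apply, PiLp.inner_apply, PiLp.norm_sq_eq_of_L2, Finset.mul_sum,
    ← Finset.sum_sub_distrib]
  refine Finset.sum_le_sum fun i _ => (hle i (ξ i) (u i)).trans ?_
  rw [real_inner_self_eq_norm_sq]
  have : δ₀ ≤ δ i := hmin i
  exact sub_le_sub_left (mul_le_mul_of_nonneg_right this (by positivity)) _

end Bank

/-! ### Storage of a signal together with its compensators -/

section StorageX

variable {N : ℕ} {n p : Fin N → ℕ} {P : ∀ i, Matrix (Fin (p i)) (Fin (p i)) ℝ}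

theorem contDiff_storageX (P : ∀ i, Matrix (Fin (p i)) (Fin (p i)) ℝ) (e : StateX n p) :
    ContDiff ℝ 1 (storageX P e) := by
  refine (contDiff_const.mul ((contDiff_fst.sub contDiff_const).norm_sq ℝ)).add ?_
  exact (contDiff_bankStorage P).comp (contDiff_snd.sub contDiff_const)

theorem storageX_self (P : ∀ i, Matrix (Fin (p i)) (Fin (p i)) ℝ) (e : StateX n p) :
    storageX P e e = 0 := by
  simp [storageX, bankStorage_zero]

/-- The storage is a positive definite quadratic form in `s - e`, so one constant serves all centres
`e`. -/
theorem exists_mul_norm_sq_le_storageX (n : Fin N → ℕ) (hP : ∀ i, (P i).PosDef) :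
    ∃ c > 0, ∀ e s : StateX n p, c * ‖s - e‖ ^ 2 ≤ storageX P e s := by
  obtain ⟨c, hc, h⟩ := exists_mul_norm_sq_le_of_homogeneous
    (V := storageX P (0 : StateX n p)) (contDiff_storageX P 0).continuous
    (fun c v => by
      simp only [storageX, Prod.fst_zero, Prod.snd_zero, sub_zero, Prod.smul_fst, Prod.smul_snd,
        norm_smul, bankStorage_smul, mul_pow, Real.norm_eq_abs, sq_abs]
      ring)
    (fun v hv => by
      simp only [storageX, Prod.fst_zero, Prod.snd_zero, sub_zero]
      by_cases h1 : v.1 = 0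
      · have h2 : v.2 ≠ 0 := fun h2 => hv (Prod.ext h1 h2)
        have := bankStorage_pos hP h2
        positivity
      · have := bankStorage_nonneg hP v.2
        positivity)
  refine ⟨c, hc, fun e s => (h (s - e)).trans_eq ?_⟩
  simp [storageX]

theorem fderiv_storageX_apply (P : ∀ i, Matrix (Fin (p i)) (Fin (p i)) ℝ) (e s v : StateX n p) :
    fderiv ℝ (storageX P e) s v =
      ⟪s.1 - e.1, v.1⟫ + fderiv ℝ (bankStorage P) (s.2 - e.2) v.2 := by
  have h1 : HasFDerivAt (fun s : StateX n p => s.1 - e.1)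
      (ContinuousLinearMap.fst ℝ (Blocks n) (Blocks p)) s := hasFDerivAt_fst.sub_const _
  have h2 : HasFDerivAt (fun s : StateX n p => s.2 - e.2)
      (ContinuousLinearMap.snd ℝ (Blocks n) (Blocks p)) s := hasFDerivAt_snd.sub_const _
  have h3 : HasFDerivAt (fun s : StateX n p => bankStorage P (s.2 - e.2)) _ s :=
    HasFDerivAt.comp (g := bankStorage P) s
      (((contDiff_bankStorage P).differentiable one_ne_zero) (s.2 - e.2)).hasFDerivAt h2
  have h4 : HasFDerivAt (storageX P e) _ s := (h1.norm_sq.const_mul (1 / 2)).add h3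
  rw [h4.fderiv]
  simp [inner_sub_left]

variable {H : ∀ i, LTI (p i) (n i)}

/-- Incremental output strict passivity of a state `x` together with a bank of compensators that is
driven by `x`. -/
theorem exists_fderiv_storageX_le (hH : ∀ i, (H i).IsCompensator (P i)) :
    ∃ δ > 0, ∀ (e s : StateX n p) (v : Blocks n), bankField H e.2 e.1 = 0 →
      fderiv ℝ (storageX P e) s (v, bankField H s.2 s.1) ≤
        ⟪s.1 - e.1, v + bankOut H s.2 s.1⟫ - δ * ‖bankOut H s.2 s.1‖ ^ 2 := by
  obtain ⟨δ, hδ, h⟩ := exists_fderiv_bankStorage_le fun i => (hH i).outputStrictlyPassive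
  refine ⟨δ, hδ, fun e s v he => ?_⟩
  -- Field and output are linear and both vanish at `e`, so passivity may be applied to the
  -- deviation.
  have hfield : bankField H s.2 s.1 = bankField H (s.2 - e.2) (s.1 - e.1) := by
    have := (bankFieldCLM H).map_sub s e
    simp only [bankFieldCLM_apply, he, sub_zero] at this
    exact this.symm
  have hout : bankOut H s.2 s.1 = bankOut H (s.2 - e.2) (s.1 - e.1) := by
    have := (bankOutCLM H).map_sub s e
    simp only [bankOutCLM_apply, bankOut_eq_zero_of_bankField_eq_zero hH he, sub_zero] at this
    exact this.symm
  rw [fderiv_storageX_apply, inner_add_right]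
  simp only
  rw [hfield, hout]
  linarith [h (s.2 - e.2) (s.1 - e.1)]

end StorageX

/-! ### Projection on tangent cones of the orthant -/

section Projection

theorem metricProj_eq_of_inner_nonpos {E : Type*} [NormedAddCommGroup E] [InnerProductSpace ℝ E]
    {K : Set E} {x c : E} (hc : c ∈ K) (h : ∀ y ∈ K, ⟪x - c, y - c⟫ ≤ 0) :
    metricProj K x = c := by
  -- This Pythagorean inequality gives minimality of `c` and also uniqueness, which is needed
  -- because `metricProj` picks its minimizer by choice.
  have hsq : ∀ y ∈ K, ‖c - x‖ ^ 2 + ‖y - c‖ ^ 2 ≤ ‖y - x‖ ^ 2 := fun y hy => by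
    have h1 : y - x = (y - c) - (x - c) := by abel
    have h2 := h y hy
    rw [h1, norm_sub_rev c x, norm_sub_sq_real (y - c), real_inner_comm]
    linarith
  have hex : ∃ c ∈ K, ∀ y ∈ K, ‖c - x‖ ≤ ‖y - x‖ := by
    refine ⟨c, hc, fun y hy => ?_⟩
    have := hsq y hy
    exact le_of_sq_le_sq (by nlinarith [sq_nonneg ‖y - c‖]) (norm_nonneg _)
  have hval : metricProj K x = hex.choose := dif_pos hex
  rw [hval]
  obtain ⟨hmem, hmin⟩ := hex.choose_spec
  have h1 := hsq _ hmem
  have h2 := pow_le_pow_left₀ (norm_nonneg _) (hmin c hc) 2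
  have h3 : ‖hex.choose - c‖ ^ 2 ≤ 0 := by linarith
  have h4 : ‖hex.choose - c‖ = 0 := by
    have := sq_nonneg ‖hex.choose - c‖
    exact pow_eq_zero_iff two_ne_zero |>.1 (le_antisymm h3 this)
  exact sub_eq_zero.1 (norm_eq_zero.1 h4)

variable {N m : ℕ}

/-- The `j`-th entry of the `i`-th block. -/
noncomputable def entryCLM (i : Fin N) (j : Fin m) : UBlocks N m →L[ℝ] ℝ :=
  (EuclideanSpace.proj (𝕜 := ℝ) j).comp (PiLp.proj (𝕜 := ℝ) 2 (fun _ : Fin N => Vec m) i)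

theorem inner_uBlocks (v w : UBlocks N m) : ⟪v, w⟫ = ∑ i, ∑ j, v i j * w i j := by
  simp [PiLp.inner_apply, mul_comm]

theorem isClosed_nonnegBlocks (N m : ℕ) : IsClosed (nonnegBlocks N m) := by
  simp only [nonnegBlocks, ofPred_forall]
  exact isClosed_iInter fun i => isClosed_iInter fun j =>
    isClosed_le continuous_const (entryCLM i j).continuous

theorem posTangentConeAt_nonnegBlocks {lam : UBlocks N m} (hlam : lam ∈ nonnegBlocks N m) :
    posTangentConeAt (nonnegBlocks N m) lam = {v | ∀ i j, lam i j = 0 → 0 ≤ v i j} := by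
  refine Subset.antisymm (fun v hv i j hij => ?_) fun v hv => ?_
  · obtain ⟨ι, l, hl, c, d, -, hd, hcd⟩ := exists_fun_of_mem_tangentConeAt hv
    refine ge_of_tendsto (((entryCLM i j).continuous.tendsto v).comp hcd) ?_
    filter_upwards [hd] with k hk
    have h1 : 0 ≤ lam i j + d k i j := hk i j
    rw [hij, zero_add] at h1
    have h2 : (entryCLM i j) (c k • d k) = c k * d k i j := rfl
    rw [Function.comp_apply, h2]
    exact mul_nonneg (c k).coe_nonneg h1
  · refine mem_posTangentConeAt_of_frequently_mem (Eventually.frequently ?_)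
    simp only [nonnegBlocks, mem_ofPred_eq, eventually_all]
    intro i j
    have hval : ∀ t : ℝ, (lam + t • v) i j = lam i j + t * v i j := fun t => rfl
    simp only [hval]
    rcases (hlam i j).eq_or_lt with h0 | h0
    · filter_upwards [self_mem_nhdsWithin] with t ht
      rw [← h0, zero_add]
      exact mul_nonneg (le_of_lt ht) (hv i j h0.symm)
    · have hcont : Tendsto (fun t : ℝ => lam i j + t * v i j) (𝓝 0) (𝓝 (lam i j + 0 * v i j)) :=
        (continuous_const.add (continuous_id.mul continuous_const)).tendsto 0
      rw [zero_mul, add_zero] at hcont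
      filter_upwards [nhdsWithin_le_nhds (hcont.eventually (lt_mem_nhds h0))] with t ht using ht.le

theorem diffProj_nonnegBlocks_apply {lam : UBlocks N m} (hlam : lam ∈ nonnegBlocks N m)
    (v : UBlocks N m) (i : Fin N) (j : Fin m) :
    diffProj (nonnegBlocks N m) lam v i j = if lam i j = 0 then max (v i j) 0 else v i j := by
  set c : UBlocks N m := col fun i => WithLp.toLp 2 fun j =>
    if lam i j = 0 then max (v i j) 0 else v i j with hc
  have hcij : ∀ i j, c i j = if lam i j = 0 then max (v i j) 0 else v i j := fun i j => rfl
  have : diffProj (nonnegBlocks N m) lam v = c := by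
    unfold diffProj
    rw [posTangentConeAt_nonnegBlocks hlam]
    refine metricProj_eq_of_inner_nonpos (fun i j hij => ?_) fun y hy => ?_
    · rw [hcij, if_pos hij]
      exact le_max_right _ _
    · rw [inner_uBlocks]
      refine Finset.sum_nonpos fun i _ => Finset.sum_nonpos fun j _ => ?_
      simp only [PiLp.sub_apply, hcij]
      split_ifs with hij
      · have := hy i j hij
        rcases le_total (v i j) 0 with h | h
        · rw [max_eq_right h]; nlinarith
        · rw [max_eq_left h]; simp
      · simp
  rw [this, hcij]

/-- The projection only raises entries of `v`, and only where `lam` is zero; there `lam - mu ≤ 0`.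
-/
theorem inner_sub_diffProj_le {lam mu : UBlocks N m} (hlam : lam ∈ nonnegBlocks N m)
    (hmu : mu ∈ nonnegBlocks N m) (v : UBlocks N m) :
    ⟪lam - mu, diffProj (nonnegBlocks N m) lam v⟫ ≤ ⟪lam - mu, v⟫ := by
  rw [inner_uBlocks, inner_uBlocks]
  refine Finset.sum_le_sum fun i _ => Finset.sum_le_sum fun j _ => ?_
  rw [diffProj_nonnegBlocks_apply hlam, PiLp.sub_apply, PiLp.sub_apply]
  split_ifs with hij
  · have := hmu i j
    have := le_max_left (v i j) 0
    rw [hij]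
    nlinarith
  · exact le_rfl

theorem norm_diffProj_nonnegBlocks_le {lam : UBlocks N m} (hlam : lam ∈ nonnegBlocks N m)
    (v : UBlocks N m) : ‖diffProj (nonnegBlocks N m) lam v‖ ≤ ‖v‖ := by
  set c := diffProj (nonnegBlocks N m) lam v with hc
  have h1 : ⟪c, c⟫ ≤ ⟪v, v⟫ := by
    rw [inner_uBlocks, inner_uBlocks]
    refine Finset.sum_le_sum fun i _ => Finset.sum_le_sum fun j _ => ?_
    rw [hc, diffProj_nonnegBlocks_apply hlam]
    split_ifs with hij
    · rcases le_total (v i j) 0 with h | h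
      · rw [max_eq_right h]; nlinarith
      · rw [max_eq_left h]
    · exact le_rfl
  rw [real_inner_self_eq_norm_sq, real_inner_self_eq_norm_sq] at h1
  exact le_of_sq_le_sq h1 (norm_nonneg _)

/-- A one-sided bound by a quantity continuous in `v`; unlike the projection itself, it survives
limits in `lam`. -/
theorem le_diffProj_nonnegBlocks {lam : UBlocks N m} (hlam : lam ∈ nonnegBlocks N m)
    (v : UBlocks N m) (i : Fin N) (j : Fin m) :
    v i j ≤ diffProj (nonnegBlocks N m) lam v i j := by
  rw [diffProj_nonnegBlocks_apply hlam]
  split_ifs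
  · exact le_max_left _ _
  · exact le_rfl

theorem diffProj_nonnegBlocks_of_ne_zero {lam : UBlocks N m} (hlam : lam ∈ nonnegBlocks N m)
    (v : UBlocks N m) {i : Fin N} {j : Fin m} (hij : lam i j ≠ 0) :
    diffProj (nonnegBlocks N m) lam v i j = v i j := by
  rw [diffProj_nonnegBlocks_apply hlam, if_neg hij]

theorem diffProj_nonnegBlocks_eq_zero_iff {lam : UBlocks N m} (hlam : lam ∈ nonnegBlocks N m)
    (v : UBlocks N m) : diffProj (nonnegBlocks N m) lam v = 0 ↔
      ∀ i j, v i j ≤ 0 ∧ (lam i j ≠ 0 → v i j = 0) := by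
  refine ⟨fun h i j => ⟨?_, fun hij => ?_⟩, fun h => ?_⟩
  · refine (le_diffProj_nonnegBlocks hlam v i j).trans_eq ?_
    rw [h]; rfl
  · rw [← diffProj_nonnegBlocks_of_ne_zero hlam v hij, h]; rfl
  · ext i j
    rw [diffProj_nonnegBlocks_apply hlam]
    split_ifs with hij
    · exact max_eq_right (h i j).1
    · exact (h i j).2 hij

end Projection

/-! ### The graph Laplacian -/

namespace Network

variable {N m : ℕ} (net : Network N)

theorem L_apply (v : UBlocks N m) (i : Fin N) : net.L v i = ∑ j, net.a i j • (v i - v j) := by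
  have h1 : net.L v i = ∑ j, net.laplacian i j • v j := rfl
  simp only [h1, laplacian, Matrix.sub_apply, Matrix.diagonal_apply, sub_smul, ite_smul, zero_smul,
    Finset.sum_sub_distrib, Finset.sum_ite_eq, Finset.mem_univ, if_true, Finset.sum_smul, smul_sub]

/-- The Laplacian as a linear map. -/
noncomputable def LCLM (m : ℕ) : UBlocks N m →L[ℝ] UBlocks N m :=
  LinearMap.toContinuousLinearMap
    { toFun := net.L
      map_add' := fun v w => by
        ext1 i
        simp only [L_apply, PiLp.add_apply, ← Finset.sum_add_distrib]
        exact Finset.sum_congr rfl fun j _ => by module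
      map_smul' := fun c v => by
        ext1 i
        simp only [L_apply, PiLp.smul_apply, RingHom.id_apply, Finset.smul_sum]
        exact Finset.sum_congr rfl fun j _ => by module }

theorem inner_L (v w : UBlocks N m) :
    ⟪net.L v, w⟫ = 1 / 2 * ∑ i, ∑ j, net.a i j * ⟪v i - v j, w i - w j⟫ := by
  have h1 : ⟪net.L v, w⟫ = ∑ i, ∑ j, net.a i j * ⟪v i - v j, w i⟫ := by
    rw [PiLp.inner_apply]
    simp only [L_apply, sum_inner, real_inner_smul_left]
  -- Exchange `i` and `j` and use the symmetry of the weights; averaging with `h1` gives the edge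
  -- form.
  have h2 : ⟪net.L v, w⟫ = -∑ i, ∑ j, net.a i j * ⟪v i - v j, w j⟫ := by
    rw [h1, Finset.sum_comm, ← Finset.sum_neg_distrib]
    refine Finset.sum_congr rfl fun i _ => ?_
    rw [← Finset.sum_neg_distrib]
    refine Finset.sum_congr rfl fun j _ => ?_
    rw [net.a_symm j i, ← neg_sub (v i), inner_neg_left]
    ring
  simp only [inner_sub_right _ (w _), mul_sub, Finset.sum_sub_distrib]
  linarith

theorem inner_L_comm (v w : UBlocks N m) : ⟪net.L v, w⟫ = ⟪v, net.L w⟫ := by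
  rw [real_inner_comm (net.L w), inner_L, inner_L]
  simp only [real_inner_comm]

theorem a_nonneg (i j : Fin N) : 0 ≤ net.a i j := by
  by_cases h : net.graph.Adj i j
  · exact (net.a_pos i j h).le
  · exact (net.a_zero i j h).ge

theorem inner_L_self_nonneg (v : UBlocks N m) : 0 ≤ ⟪net.L v, v⟫ := by
  rw [inner_L]
  have : ∀ i j, 0 ≤ net.a i j * ⟪v i - v j, v i - v j⟫ := fun i j =>
    mul_nonneg (net.a_nonneg i j) real_inner_self_nonneg
  have := Finset.sum_nonneg fun i (_ : i ∈ Finset.univ) =>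
    Finset.sum_nonneg fun j (_ : j ∈ Finset.univ) => this i j
  linarith

/-- The kernel of the Laplacian of a connected graph consists of the consensual vectors. -/
theorem eq_of_L_eq_zero {net : Network N} (hnet : net.graph.Connected) {v : UBlocks N m}
    (h : net.L v = 0) (i j : Fin N) : v i = v j := by
  have hterm : ∀ i j, 0 ≤ net.a i j * ⟪v i - v j, v i - v j⟫ := fun i j =>
    mul_nonneg (net.a_nonneg i j) real_inner_self_nonneg
  have hsum : ∑ i, ∑ j, net.a i j * ⟪v i - v j, v i - v j⟫ = 0 := by
    have := net.inner_L v v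
    rw [h, inner_zero_left] at this
    linarith
  have hzero : ∀ i j, net.a i j * ⟪v i - v j, v i - v j⟫ = 0 := fun i j => by
    have h1 := (Finset.sum_eq_zero_iff_of_nonneg fun i _ =>
      Finset.sum_nonneg fun j _ => hterm i j).1 hsum i (Finset.mem_univ i)
    exact (Finset.sum_eq_zero_iff_of_nonneg fun j _ => hterm i j).1 h1 j (Finset.mem_univ j)
  have hadj : ∀ i j, net.graph.Adj i j → v i = v j := fun i j hij => by
    rcases mul_eq_zero.1 (hzero i j) with h0 | h0
    · exact absurd h0 (net.a_pos i j hij).ne'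
    · exact sub_eq_zero.1 (inner_self_eq_zero.1 h0)
  obtain ⟨w⟩ := hnet.preconnected i j
  induction w with
  | nil => rfl
  | cons hij _ ih => exact (hadj _ _ hij).trans ih

theorem sum_L (v : UBlocks N m) : ∑ i, net.L v i = 0 := by
  refine ext_inner_right ℝ fun y => ?_
  have h1 := net.inner_L v (col fun _ => y)
  rw [PiLp.inner_apply] at h1
  simpa [col_apply, sum_inner] using h1

end Network

/-! ### Continuity and convexity of the game data -/

section Game

variable {N m : ℕ} {n : Fin N → ℕ}

theorem replaceBlock_same (x : Blocks n) (i : Fin N) (y : Vec (n i)) :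
    replaceBlock x i y i = y := by
  simp [replaceBlock]

theorem replaceBlock_of_ne (x : Blocks n) {i j : Fin N} (h : j ≠ i) (y : Vec (n i)) :
    replaceBlock x i y j = x j := by
  simp [replaceBlock, h]

theorem replaceBlock_self (x : Blocks n) (i : Fin N) : replaceBlock x i (x i) = x := by
  simp [replaceBlock]

theorem replaceBlock_replaceBlock (x : Blocks n) (i : Fin N) (y z : Vec (n i)) :
    replaceBlock (replaceBlock x i y) i z = replaceBlock x i z := by
  simp [replaceBlock]

namespace Game

variable {Γ : Game n m}

theorem F_apply (x : Blocks n) (i : Fin N) :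
    Γ.F x i = gradient (fun y => Γ.J i (replaceBlock x i y)) (x i) := rfl

theorem gradGT_apply (x : Blocks n) (lam : UBlocks N m) (i : Fin N) :
    Γ.gradGT x lam i = ContinuousLinearMap.adjoint (fderiv ℝ (Γ.g i) (x i)) (lam i) := rfl

theorem G_apply (x : Blocks n) (i : Fin N) : Γ.G x i = Γ.g i (x i) := rfl

/-- A monotone pseudo-gradient is continuous, although the costs are only assumed to be smooth in
the players' own variables. -/
theorem Regular.continuous_F (hΓ : Γ.Regular) (hF : IsMonotoneOp Γ.F) : Continuous Γ.F := by
  refine continuous_iff_continuousAt.2 fun x₀ => hF.continuousAt fun v hv => ?_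
  ext1 i
  refine eq_gradient_of_forall_inner_nonneg
    ((hΓ.cost_contDiff i x₀).differentiable one_ne_zero) fun y => ?_
  -- Testing with a unilateral deviation leaves only block `i` of the inner product, where the
  -- pseudo-gradient is the gradient of one function of `y`.
  have h1 := hv (replaceBlock x₀ i y)
  rw [PiLp.inner_apply, Finset.sum_eq_single i] at h1
  · simpa only [PiLp.sub_apply, F_apply, replaceBlock_same, replaceBlock_replaceBlock] using h1
  · intro j _ hji
    simp [replaceBlock_of_ne x₀ hji y]
  · simp

theorem Regular.continuous_G (hΓ : Γ.Regular) : Continuous Γ.G :=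
  (PiLp.continuous_toLp 2 _).comp <| continuous_pi fun i =>
    (hΓ.constr_differentiable i).continuous.comp (PiLp.continuous_apply 2 _ i)

theorem Regular.differentiable_constr_apply (hΓ : Γ.Regular) (i : Fin N) (k : Fin m) :
    Differentiable ℝ fun y => Γ.g i y k := fun y =>
  (EuclideanSpace.proj (𝕜 := ℝ) k).differentiableAt.comp y (hΓ.constr_differentiable i y)

theorem Regular.fderiv_constr_apply (hΓ : Γ.Regular) (i : Fin N) (k : Fin m) (y v : Vec (n i)) :
    fderiv ℝ (Γ.g i) y v k = fderiv ℝ (fun y => Γ.g i y k) y v := by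
  have h : HasFDerivAt (fun y => Γ.g i y k) _ y :=
    (EuclideanSpace.proj (𝕜 := ℝ) k).hasFDerivAt.comp y (hΓ.constr_differentiable i y).hasFDerivAt
  rw [h.fderiv]
  rfl

theorem Regular.adjoint_fderiv_apply (hΓ : Γ.Regular) (i : Fin N) (y : Vec (n i)) (lam : Vec m) :
    ContinuousLinearMap.adjoint (fderiv ℝ (Γ.g i) y) lam =
      ∑ k, lam k • gradient (fun y => Γ.g i y k) y := by
  refine ext_inner_right ℝ fun v => ?_
  rw [ContinuousLinearMap.adjoint_inner_left, sum_inner, PiLp.inner_apply]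
  refine Finset.sum_congr rfl fun k _ => ?_
  rw [hΓ.fderiv_constr_apply, real_inner_smul_left]
  simp [gradient, mul_comm]

theorem Regular.continuous_gradGT (hΓ : Γ.Regular) :
    Continuous fun a : Blocks n × UBlocks N m => Γ.gradGT a.1 a.2 := by
  refine (PiLp.continuous_toLp 2 _).comp <| continuous_pi fun i => ?_
  simp only [hΓ.adjoint_fderiv_apply]
  refine continuous_finsetSum _ fun k _ => Continuous.fun_smul ?_ ?_
  · exact (entryCLM i k).continuous.comp continuous_snd
  · exact ((hΓ.constr_convex i k).continuous_gradient (hΓ.differentiable_constr_apply i k)).comp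
      ((PiLp.continuous_apply 2 _ i).comp continuous_fst)

/-- The gradient inequality of each convex component, weighted by its nonnegative multiplier. -/
theorem Regular.inner_adjoint_fderiv_le (hΓ : Γ.Regular) (i : Fin N) {lam : Vec m}
    (hlam : lam ∈ nonnegVec m) (x y : Vec (n i)) :
    ⟪y - x, ContinuousLinearMap.adjoint (fderiv ℝ (Γ.g i) x) lam⟫ ≤ ⟪lam, Γ.g i y - Γ.g i x⟫ := by
  rw [ContinuousLinearMap.adjoint_inner_right, real_inner_comm, PiLp.inner_apply, PiLp.inner_apply]
  refine Finset.sum_le_sum fun k _ => ?_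
  have h1 := (hΓ.constr_convex i k).fderiv_le_sub (hΓ.differentiable_constr_apply i k x) y
  rw [← hΓ.fderiv_constr_apply] at h1
  simp only [RCLike.inner_apply, conj_trivial, PiLp.sub_apply]
  exact mul_le_mul_of_nonneg_right h1 (hlam k)

/-- The saddle operator of the constraint coupling is monotone on nonnegative multipliers. -/
theorem Regular.inner_G_sub_le (hΓ : Γ.Regular) {lam mu : UBlocks N m}
    (hlam : lam ∈ nonnegBlocks N m) (hmu : mu ∈ nonnegBlocks N m) (u x : Blocks n) :
    ⟪lam - mu, Γ.G u - Γ.G x⟫ ≤ ⟪u - x, Γ.gradGT u lam - Γ.gradGT x mu⟫ := by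
  rw [PiLp.inner_apply, PiLp.inner_apply]
  refine Finset.sum_le_sum fun i _ => ?_
  simp only [PiLp.sub_apply, G_apply, gradGT_apply]
  have h1 := hΓ.inner_adjoint_fderiv_le i (hlam i) (u i) (x i)
  have h2 := hΓ.inner_adjoint_fderiv_le i (hmu i) (x i) (u i)
  rw [← neg_sub (u i), inner_neg_left, ← neg_sub (Γ.g i (u i)), inner_neg_right] at h1
  rw [inner_sub_left, inner_sub_right (u i - x i)]
  linarith

end Game

end Game

/-! ### Equilibrium relations and passivity of the subsystems -/

section Passivity

variable {N m : ℕ} {n p r q : Fin N → ℕ} {Γ : Game n m} {net : Network N}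
  {Hx : ∀ i, LTI (p i) (n i)} {Hl : ∀ i, LTI (r i) m} {Hz : ∀ i, LTI (q i) m}
  {Px : ∀ i, Matrix (Fin (p i)) (Fin (p i)) ℝ} {Pl : ∀ i, Matrix (Fin (r i)) (Fin (r i)) ℝ}
  {Pz : ∀ i, Matrix (Fin (q i)) (Fin (q i)) ℝ}

theorem storageLZ_eq (e s : StateLZ m r q) :
    storageLZ Pl Pz e s = storageX Pl e.1 s.1 + storageX Pz e.2 s.2 := rfl

theorem contDiff_storageLZ (e : StateLZ m r q) : ContDiff ℝ 1 (storageLZ Pl Pz e) :=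
  ((contDiff_storageX Pl e.1).comp contDiff_fst).add
    ((contDiff_storageX Pz e.2).comp contDiff_snd)

theorem fderiv_comp_fst_add_comp_snd_apply {E F : Type*} [NormedAddCommGroup E] [NormedSpace ℝ E]
    [NormedAddCommGroup F] [NormedSpace ℝ F] {V : E → ℝ} {W : F → ℝ} (hV : ContDiff ℝ 1 V)
    (hW : ContDiff ℝ 1 W) (s v : E × F) :
    fderiv ℝ (fun s : E × F => V s.1 + W s.2) s v = fderiv ℝ V s.1 v.1 + fderiv ℝ W s.2 v.2 := by
  have h1 : HasFDerivAt (fun s : E × F => V s.1) _ s :=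
    HasFDerivAt.comp (g := V) s ((hV.differentiable one_ne_zero) s.1).hasFDerivAt hasFDerivAt_fst
  have h2 : HasFDerivAt (fun s : E × F => W s.2) _ s :=
    HasFDerivAt.comp (g := W) s ((hW.differentiable one_ne_zero) s.2).hasFDerivAt hasFDerivAt_snd
  have h3 : HasFDerivAt (fun s : E × F => V s.1 + W s.2) _ s := h1.add h2
  rw [h3.fderiv]
  rfl

theorem exists_mul_norm_sq_le_prod {E F : Type*} [NormedAddCommGroup E] [NormedAddCommGroup F]
    {V : E → E → ℝ} {W : F → F → ℝ} (hV : ∃ c > 0, ∀ e s, c * ‖s - e‖ ^ 2 ≤ V e s)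
    (hW : ∃ c > 0, ∀ e s, c * ‖s - e‖ ^ 2 ≤ W e s) :
    ∃ c > 0, ∀ e s : E × F, c * ‖s - e‖ ^ 2 ≤ V e.1 s.1 + W e.2 s.2 := by
  obtain ⟨a, ha, hV⟩ := hV
  obtain ⟨b, hb, hW⟩ := hW
  refine ⟨min a b, lt_min ha hb, fun e s => ?_⟩
  have h1 := hV e.1 s.1
  have h2 := hW e.2 s.2
  have h3 : min a b * ‖s.1 - e.1‖ ^ 2 ≤ a * ‖s.1 - e.1‖ ^ 2 := by gcongr; exact min_le_left _ _
  have h4 : min a b * ‖s.2 - e.2‖ ^ 2 ≤ b * ‖s.2 - e.2‖ ^ 2 := by gcongr; exact min_le_right _ _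
  have h5 : 0 ≤ min a b * ‖s.1 - e.1‖ ^ 2 := mul_nonneg (lt_min ha hb).le (by positivity)
  have h6 : 0 ≤ min a b * ‖s.2 - e.2‖ ^ 2 := mul_nonneg (lt_min ha hb).le (by positivity)
  rw [Prod.norm_def, Prod.fst_sub, Prod.snd_sub]
  rcases max_cases ‖s.1 - e.1‖ ‖s.2 - e.2‖ with ⟨h, -⟩ | ⟨h, -⟩ <;> rw [h] <;> linarith

theorem exists_mul_norm_sq_le_storageLZ (m : ℕ) (hPl : ∀ i, (Pl i).PosDef)
    (hPz : ∀ i, (Pz i).PosDef) :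
    ∃ c > 0, ∀ e s : StateLZ m r q, c * ‖s - e‖ ^ 2 ≤ storageLZ Pl Pz e s :=
  exists_mul_norm_sq_le_prod (exists_mul_norm_sq_le_storageX _ hPl)
    (exists_mul_norm_sq_le_storageX _ hPz)

section Equilibrium

variable {e : State n p m r q}

theorem IsEquilibrium.bankField_x (he : IsEquilibrium Γ net Hx Hl Hz e) :
    bankField Hx e.1.2 e.1.1 = 0 := congrArg (fun v => v.1.2) he.2

theorem IsEquilibrium.bankField_lam (he : IsEquilibrium Γ net Hx Hl Hz e) :
    bankField Hl e.2.1.2 e.2.1.1 = 0 := congrArg (fun v => v.2.1.2) he.2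

theorem IsEquilibrium.bankField_z (he : IsEquilibrium Γ net Hx Hl Hz e) :
    bankField Hz e.2.2.2 e.2.2.1 = 0 := congrArg (fun v => v.2.2.2) he.2

theorem IsEquilibrium.F_eq (hHx : ∀ i, (Hx i).IsCompensator (Px i))
    (he : IsEquilibrium Γ net Hx Hl Hz e) : Γ.F e.1.1 = -Γ.gradGT e.1.1 e.2.1.1 := by
  have h1 : -Γ.F e.1.1 - Γ.gradGT e.1.1 e.2.1.1 - bankOut Hx e.1.2 e.1.1 = 0 :=
    congrArg (fun v => v.1.1) he.2
  rw [bankOut_eq_zero_of_bankField_eq_zero hHx he.bankField_x, sub_zero, sub_eq_zero] at h1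
  rw [← h1, neg_neg]

theorem IsEquilibrium.L_lam_eq_zero (hHz : ∀ i, (Hz i).IsCompensator (Pz i))
    (he : IsEquilibrium Γ net Hx Hl Hz e) : net.L e.2.1.1 = 0 := by
  have h1 : net.L e.2.1.1 - bankOut Hz e.2.2.2 e.2.2.1 = 0 := congrArg (fun v => v.2.2.1) he.2
  rwa [bankOut_eq_zero_of_bankField_eq_zero hHz he.bankField_z, sub_zero] at h1

theorem IsEquilibrium.diffProj_eq_zero (hHl : ∀ i, (Hl i).IsCompensator (Pl i))
    (hHz : ∀ i, (Hz i).IsCompensator (Pz i)) (he : IsEquilibrium Γ net Hx Hl Hz e) :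
    diffProj (nonnegBlocks N m) e.2.1.1 (Γ.G e.1.1 - net.L e.2.2.1) = 0 := by
  have h1 : diffProj (nonnegBlocks N m) e.2.1.1 (Γ.G e.1.1 - net.L e.2.2.1 - net.L e.2.1.1 -
    bankOut Hl e.2.1.2 e.2.1.1) = 0 := congrArg (fun v => v.2.1.1) he.2
  rwa [bankOut_eq_zero_of_bankField_eq_zero hHl he.bankField_lam, he.L_lam_eq_zero hHz, sub_zero,
    sub_zero] at h1

end Equilibrium

/-- Keeps the dissipation term that plain passivity discards; the invariance argument needs it. The
margin does not depend on the equilibrium. -/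
theorem exists_fderiv_storageX_sigmaXField_le (hF : IsMonotoneOp Γ.F)
    (hHx : ∀ i, (Hx i).IsCompensator (Px i)) :
    ∃ δ > 0, ∀ e : State n p m r q, IsEquilibrium Γ net Hx Hl Hz e → ∀ s u,
      fderiv ℝ (storageX Px e.1) s (sigmaXField Γ Hx s u) ≤
        ⟪u - -Γ.gradGT e.1.1 e.2.1.1, s.1 - e.1.1⟫ - δ * ‖bankOut Hx s.2 s.1‖ ^ 2 := by
  obtain ⟨δ, hδ, h⟩ := exists_fderiv_storageX_le hHx
  refine ⟨δ, hδ, fun e he s u => (h e.1 s _ he.bankField_x).trans ?_⟩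
  rw [sub_add_cancel, ← he.F_eq hHx]
  have h1 := hF s.1 e.1.1
  have h2 : -Γ.F s.1 + u = (u - Γ.F e.1.1) - (Γ.F s.1 - Γ.F e.1.1) := by abel
  rw [h2, inner_sub_right (s.1 - e.1.1), real_inner_comm (u - _)]
  linarith

theorem exists_fderiv_storageLZ_sigmaLZField_le (hΓ : Γ.Regular)
    (hHl : ∀ i, (Hl i).IsCompensator (Pl i)) (hHz : ∀ i, (Hz i).IsCompensator (Pz i)) :
    ∃ δ > 0, ∃ ε > 0, ∀ e : State n p m r q, IsEquilibrium Γ net Hx Hl Hz e →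
      ∀ s ∈ domainLZ m r q, ∀ u,
      fderiv ℝ (storageLZ Pl Pz e.2) s (sigmaLZField Γ net Hl Hz s u) ≤
        ⟪u - e.1.1, Γ.gradGT u s.1.1 - Γ.gradGT e.1.1 e.2.1.1⟫ -
          (δ * ‖bankOut Hl s.1.2 s.1.1‖ ^ 2 + ε * ‖bankOut Hz s.2.2 s.2.1‖ ^ 2) := by
  obtain ⟨δ, hδ, hl⟩ := exists_fderiv_storageX_le hHl
  obtain ⟨ε, hε, hz⟩ := exists_fderiv_storageX_le hHz
  refine ⟨δ, hδ, ε, hε, fun e he s hs u => ?_⟩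
  have hfd := fderiv_comp_fst_add_comp_snd_apply (contDiff_storageX Pl e.2.1)
    (contDiff_storageX Pz e.2.2) s (sigmaLZField Γ net Hl Hz s u)
  have hfd : fderiv ℝ (storageLZ Pl Pz e.2) s (sigmaLZField Γ net Hl Hz s u) = _ := hfd
  rw [hfd]
  have h1 := hl e.2.1 s.1 (sigmaLZField Γ net Hl Hz s u).1.1 he.bankField_lam
  have h2 := hz e.2.2 s.2 (sigmaLZField Γ net Hl Hz s u).2.1 he.bankField_z
  refine (add_le_add h1 h2).trans ?_
  simp only [sigmaLZField, sub_add_cancel]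
  rw [inner_add_right]
  have h3 := inner_sub_diffProj_le hs he.1
    (Γ.G u - net.L s.2.1 - net.L s.1.1 - bankOut Hl s.1.2 s.1.1)
  -- With the roles of `λ` and `λ*` exchanged, this is the variational inequality of the equilibrium
  -- multiplier: `⟪λ - λ*, G(x*) - L z*⟫ ≤ 0`.
  have h4 := inner_sub_diffProj_le he.1 hs (Γ.G e.1.1 - net.L e.2.2.1)
  rw [he.diffProj_eq_zero hHl hHz, inner_zero_right, ← neg_sub s.1.1, inner_neg_left] at h4
  have h5 := hΓ.inner_G_sub_le hs he.1 u e.1.1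
  have hLsub : ∀ v w : UBlocks N m, net.L (v - w) = net.L v - net.L w := fun v w =>
    (net.LCLM m).map_sub v w
  have h6 := net.inner_L_self_nonneg (s.1.1 - e.2.1.1)
  -- By symmetry of `L`, the term `-L z` in the multiplier equation cancels `L λ` in the equation of
  -- `z`.
  have h7 := net.inner_L_comm (s.1.1 - e.2.1.1) (s.2.1 - e.2.2.1)
  rw [real_inner_comm, hLsub, he.L_lam_eq_zero hHz, sub_zero] at h6
  rw [hLsub, hLsub, he.L_lam_eq_zero hHz, sub_zero, real_inner_comm] at h7
  have h8 : Γ.G u - net.L s.2.1 - net.L s.1.1 - bankOut Hl s.1.2 s.1.1 =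
      (Γ.G u - Γ.G e.1.1) + (Γ.G e.1.1 - net.L e.2.2.1) - (net.L s.2.1 - net.L e.2.2.1) -
        net.L s.1.1 - bankOut Hl s.1.2 s.1.1 := by abel
  have h9 : ⟪s.1.1 - e.2.1.1, Γ.G u - net.L s.2.1 - net.L s.1.1 - bankOut Hl s.1.2 s.1.1⟫ =
      ⟪s.1.1 - e.2.1.1, Γ.G u - Γ.G e.1.1⟫ + ⟪s.1.1 - e.2.1.1, Γ.G e.1.1 - net.L e.2.2.1⟫ -
        ⟪s.1.1 - e.2.1.1, net.L s.2.1 - net.L e.2.2.1⟫ - ⟪s.1.1 - e.2.1.1, net.L s.1.1⟫ -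
        ⟪s.1.1 - e.2.1.1, bankOut Hl s.1.2 s.1.1⟫ := by
    rw [h8, inner_sub_right _ _ (bankOut Hl s.1.2 s.1.1), inner_sub_right _ _ (net.L s.1.1),
      inner_sub_right _ _ (net.L s.2.1 - net.L e.2.2.1), inner_add_right]
  rw [h9] at h3
  linarith

theorem isPassiveAt_sigmaX (hF : IsMonotoneOp Γ.F) (hHx : ∀ i, (Hx i).IsCompensator (Px i))
    {e : State n p m r q} (he : IsEquilibrium Γ net Hx Hl Hz e) :
    IsPassiveAt univ (sigmaXField Γ Hx) sigmaXOut (storageX Px e.1) e.1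
      (-Γ.gradGT e.1.1 e.2.1.1) := by
  obtain ⟨c, hc, hlow⟩ := exists_mul_norm_sq_le_storageX n
    fun i => (hHx i).outputStrictlyPassive.1
  refine ⟨mem_univ _, ?_, contDiff_storageX Px e.1, storageX_self Px e.1, fun s hs => ?_,
    tendsto_cocompact_atTop_of_mul_norm_sq_le hc e.1 (hlow e.1), fun s _ u => ?_⟩
  · refine Prod.ext ?_ he.bankField_x
    simp only [sigmaXField, Prod.fst_zero]
    rw [bankOut_eq_zero_of_bankField_eq_zero hHx he.bankField_x, he.F_eq hHx]
    simp
  · have : 0 < ‖s - e.1‖ := norm_pos_iff.2 (sub_ne_zero.2 hs)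
    exact lt_of_lt_of_le (by positivity) (hlow e.1 s)
  · obtain ⟨δ, hδ, h⟩ := exists_fderiv_storageX_sigmaXField_le (net := net) (Hl := Hl) (Hz := Hz)
      hF hHx
    refine (h e he s u).trans (sub_le_self _ (by positivity))

theorem isPassiveAt_sigmaLZ (hΓ : Γ.Regular) (hHl : ∀ i, (Hl i).IsCompensator (Pl i))
    (hHz : ∀ i, (Hz i).IsCompensator (Pz i))
    {e : State n p m r q} (he : IsEquilibrium Γ net Hx Hl Hz e) :
    IsPassiveAt (domainLZ m r q) (sigmaLZField Γ net Hl Hz) (sigmaLZOut Γ)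
      (storageLZ Pl Pz e.2) e.2 e.1.1 := by
  obtain ⟨c, hc, hlow⟩ := exists_mul_norm_sq_le_storageLZ m
    (fun i => (hHl i).outputStrictlyPassive.1) fun i => (hHz i).outputStrictlyPassive.1
  refine ⟨he.1, congrArg Prod.snd he.2, contDiff_storageLZ e.2, ?_, fun s hs => ?_,
    tendsto_cocompact_atTop_of_mul_norm_sq_le hc e.2 (hlow e.2), fun s hs u => ?_⟩
  · rw [storageLZ_eq, storageX_self, storageX_self, add_zero]
  · have : 0 < ‖s - e.2‖ := norm_pos_iff.2 (sub_ne_zero.2 hs)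
    exact lt_of_lt_of_le (by positivity) (hlow e.2 s)
  · obtain ⟨δ, hδ, ε, hε, h⟩ := exists_fderiv_storageLZ_sigmaLZField_le (net := net) (Hx := Hx)
      hΓ hHl hHz
    exact (h e he s hs u).trans (sub_le_self _ (by positivity))

end Passivity

/-! ### Equilibria are variational GNEs -/

section KKT

variable {N m : ℕ} {n p r q : Fin N → ℕ} {Γ : Game n m} {net : Network N}
  {Hx : ∀ i, LTI (p i) (n i)} {Hl : ∀ i, LTI (r i) m} {Hz : ∀ i, LTI (q i) m}
  {Px : ∀ i, Matrix (Fin (p i)) (Fin (p i)) ℝ} {Pl : ∀ i, Matrix (Fin (r i)) (Fin (r i)) ℝ}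
  {Pz : ∀ i, Matrix (Fin (q i)) (Fin (q i)) ℝ}

theorem Game.gSum_apply (Γ : Game n m) (x : Blocks n) (k : Fin m) :
    Γ.gSum x k = ∑ i, Γ.g i (x i) k := by
  simp [Game.gSum]

theorem Game.gSum_replaceBlock_sub (Γ : Game n m) (x : Blocks n) (i : Fin N) (y : Vec (n i)) :
    Γ.gSum (replaceBlock x i y) - Γ.gSum x = Γ.g i y - Γ.g i (x i) := by
  rw [Game.gSum, Game.gSum, ← Finset.sum_sub_distrib, Finset.sum_eq_single i]
  · rw [replaceBlock_same]
  · intro j _ hji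
    rw [replaceBlock_of_ne x hji, sub_self]
  · simp

/-- The KKT conditions with a common multiplier are sufficient for a generalized Nash
equilibrium. -/
theorem Game.Regular.isVariationalGNE_of_kkt (hΓ : Γ.Regular) {x : Blocks n} {lam : Vec m}
    (hlam : lam ∈ nonnegVec m) (hx : x ∈ Γ.feasible)
    (hstat : ∀ i, gradient (fun y => Γ.J i (replaceBlock x i y)) (x i) +
      ContinuousLinearMap.adjoint (fderiv ℝ (Γ.g i) (x i)) lam = 0)
    (hcomp : ⟪lam, Γ.gSum x⟫ = 0) : Γ.IsVariationalGNE x := by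
  have hnonpos : ∀ y ∈ nonnegVec m, ∀ w : Vec m, (∀ k, w k ≤ 0) → ⟪y, w⟫ ≤ 0 := fun y hy w hw => by
    rw [PiLp.inner_apply]
    exact Finset.sum_nonpos fun k _ => by
      simpa using mul_nonpos_of_nonpos_of_nonneg (hw k) (hy k)
  refine ⟨⟨hx, fun i y hy => ?_⟩, lam, hlam, hstat, fun y hy => ?_⟩
  · have h1 := (hΓ.cost_convex i x).inner_gradient_le_sub
      ((hΓ.cost_contDiff i x).differentiable one_ne_zero (x i)) y
    simp only [replaceBlock_self] at h1
    have h2 := hΓ.inner_adjoint_fderiv_le i hlam (x i) y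
    rw [eq_neg_of_add_eq_zero_left (hstat i), inner_neg_left, real_inner_comm] at h1
    rw [← Γ.gSum_replaceBlock_sub x i y, inner_sub_right, hcomp] at h2
    have h3 := hnonpos lam hlam _ hy
    linarith
  · rw [inner_sub_right, real_inner_comm lam, hcomp, sub_zero, real_inner_comm]
    exact hnonpos y hy _ hx

theorem IsEquilibrium.isVariationalGNE (hΓ : Γ.Regular) (hnet : net.graph.Connected)
    (hHx : ∀ i, (Hx i).IsCompensator (Px i)) (hHl : ∀ i, (Hl i).IsCompensator (Pl i))
    (hHz : ∀ i, (Hz i).IsCompensator (Pz i)) {e : State n p m r q}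
    (he : IsEquilibrium Γ net Hx Hl Hz e) : Γ.IsVariationalGNE e.1.1 := by
  obtain ⟨i₀⟩ := hnet.nonempty
  have hcons : ∀ i, e.2.1.1 i = e.2.1.1 i₀ := fun i =>
    Network.eq_of_L_eq_zero hnet (he.L_lam_eq_zero hHz) i i₀
  have hproj := (diffProj_nonnegBlocks_eq_zero_iff he.1 _).1 (he.diffProj_eq_zero hHl hHz)
  -- The blocks of `L z` sum to zero, so the local conditions add up to feasibility and
  -- complementarity of the coupling constraint.
  have hsum : ∀ k, Γ.gSum e.1.1 k = ∑ i, (Γ.G e.1.1 - net.L e.2.2.1) i k := fun k => by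
    have h1 : ∑ i, net.L e.2.2.1 i k = 0 := by
      have := congrArg (fun v : Vec m => v k) (net.sum_L e.2.2.1)
      simpa using this
    simp only [PiLp.sub_apply, Finset.sum_sub_distrib, h1, sub_zero, Game.gSum_apply, Game.G_apply]
  refine hΓ.isVariationalGNE_of_kkt (he.1 i₀) (fun k => ?_) (fun i => ?_) ?_
  · rw [hsum]
    exact Finset.sum_nonpos fun i _ => (hproj i k).1
  · have h1 := congrArg (fun v : Blocks n => v i) (he.F_eq hHx)
    simp only [PiLp.neg_apply, Game.F_apply, Game.gradGT_apply, hcons i] at h1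
    rw [h1, neg_add_cancel]
  · rw [PiLp.inner_apply]
    refine Finset.sum_eq_zero fun k _ => ?_
    by_cases hk : e.2.1.1 i₀ k = 0
    · simp [hk]
    · have : Γ.gSum e.1.1 k = 0 := by
        rw [hsum]
        exact Finset.sum_eq_zero fun i _ => (hproj i k).2 (by rwa [hcons i])
      simp [this]

end KKT

/-! ### Stationary points of discontinuous fields -/

section Stationary

variable {E H : Type*} [NormedAddCommGroup E] [NormedSpace ℝ E]
  [NormedAddCommGroup H] [NormedSpace ℝ H]

/-- `f` is not bounded away from zero in any direction near `x` within `D`. -/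
def IsStationary (f : E → E) (D : Set E) (x : E) : Prop :=
  ∀ (l : E →L[ℝ] ℝ) (r : ℝ), (∀ᶠ y in 𝓝[D] x, r ≤ l (f y)) → r ≤ 0

theorem IsStationary.nonpos_of_le {f : E → E} {D : Set E} {x : E} (h : IsStationary f D x)
    (l : E →L[ℝ] ℝ) {v : E → ℝ} (hv : ContinuousWithinAt v D x)
    (hle : ∀ᶠ y in 𝓝[D] x, v y ≤ l (f y)) : v x ≤ 0 := by
  by_contra! hpos
  have := h l (v x / 2) (by
    filter_upwards [hle, hv.eventually (lt_mem_nhds (half_lt_self hpos))] with y h1 h2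
    exact h2.le.trans h1)
  linarith

/-- Test with every functional and its negative; functionals separate points. -/
theorem IsStationary.comp_eq_zero {f : E → E} {D : Set E} {x : E} (h : IsStationary f D x)
    (π : E →L[ℝ] H) (hcont : ContinuousWithinAt (fun y => π (f y)) D x) : π (f x) = 0 := by
  have key : ∀ ψ : H →L[ℝ] ℝ, ψ (π (f x)) ≤ 0 := fun ψ =>
    h.nonpos_of_le (ψ.comp π) (v := fun y => ψ (π (f y)))
      (ψ.continuous.continuousAt.comp_continuousWithinAt hcont)
      (Filter.Eventually.of_forall fun y => le_rfl)
  refine (SeparatingDual.eq_zero_iff_forall_dual_eq_zero (R := ℝ) _).2 fun ψ =>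
    le_antisymm (key ψ) ?_
  simpa using key (-ψ)

end Stationary

/-! ### Lyapunov decay and convergence of the full dynamics -/

section Convergence

variable {N m : ℕ} {n p r q : Fin N → ℕ} {Γ : Game n m} {net : Network N}
  {Hx : ∀ i, LTI (p i) (n i)} {Hl : ∀ i, LTI (r i) m} {Hz : ∀ i, LTI (q i) m}
  {Px : ∀ i, Matrix (Fin (p i)) (Fin (p i)) ℝ} {Pl : ∀ i, Matrix (Fin (r i)) (Fin (r i)) ℝ}
  {Pz : ∀ i, Matrix (Fin (q i)) (Fin (q i)) ℝ}

theorem isClosed_domain : IsClosed (domain n p m r q) :=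
  (isClosed_nonnegBlocks N m).preimage (continuous_fst.comp (continuous_fst.comp continuous_snd))

theorem continuous_bankField {d : Fin N → ℕ} (H : ∀ i, LTI (p i) (d i)) :
    Continuous fun s : Blocks d × Blocks p => bankField H s.2 s.1 := (bankFieldCLM H).continuous

theorem continuous_bankOut {d : Fin N → ℕ} (H : ∀ i, LTI (p i) (d i)) :
    Continuous fun s : Blocks d × Blocks p => bankOut H s.2 s.1 := (bankOutCLM H).continuous

/-- The argument of the projection in the multiplier dynamics. -/
noncomputable def multiplierDrift (Γ : Game n m) (net : Network N) (Hl : ∀ i, LTI (r i) m)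
    (s : State n p m r q) : UBlocks N m :=
  Γ.G s.1.1 - net.L s.2.2.1 - net.L s.2.1.1 - bankOut Hl s.2.1.2 s.2.1.1

/-- The dynamics without the projection. -/
noncomputable def unprojectedDynamics (Γ : Game n m) (net : Network N)
    (Hx : ∀ i, LTI (p i) (n i)) (Hl : ∀ i, LTI (r i) m) (Hz : ∀ i, LTI (q i) m)
    (s : State n p m r q) : State n p m r q :=
  ((-Γ.F s.1.1 - Γ.gradGT s.1.1 s.2.1.1 - bankOut Hx s.1.2 s.1.1, bankField Hx s.1.2 s.1.1),
   ((multiplierDrift Γ net Hl s, bankField Hl s.2.1.2 s.2.1.1),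
    (net.L s.2.1.1 - bankOut Hz s.2.2.2 s.2.2.1, bankField Hz s.2.2.2 s.2.2.1)))

theorem dynamics_eq (s : State n p m r q) : dynamics Γ net Hx Hl Hz s =
    ((unprojectedDynamics Γ net Hx Hl Hz s).1,
      ((diffProj (nonnegBlocks N m) s.2.1.1 (multiplierDrift Γ net Hl s),
        (unprojectedDynamics Γ net Hx Hl Hz s).2.1.2),
      (unprojectedDynamics Γ net Hx Hl Hz s).2.2)) := rfl

theorem continuous_multiplierDrift (hΓ : Γ.Regular) :
    Continuous (multiplierDrift (p := p) (q := q) Γ net Hl) := by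
  have hL : Continuous (net.L : UBlocks N m → UBlocks N m) := (net.LCLM m).continuous
  have hl := (continuous_bankOut Hl).comp
    (continuous_fst.comp continuous_snd : Continuous fun s : State n p m r q => s.2.1)
  exact (((hΓ.continuous_G.comp (by fun_prop)).sub (hL.comp (by fun_prop))).sub
    (hL.comp (by fun_prop))).sub hl

theorem continuous_unprojectedDynamics (hΓ : Γ.Regular) (hF : IsMonotoneOp Γ.F) :
    Continuous (unprojectedDynamics Γ net Hx Hl Hz) := by
  have hL : Continuous (net.L : UBlocks N m → UBlocks N m) := (net.LCLM m).continuous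
  have h1 : Continuous fun s : State n p m r q => s.1 := continuous_fst
  have h2 : Continuous fun s : State n p m r q => s.2.1 := by fun_prop
  have h3 : Continuous fun s : State n p m r q => s.2.2 := by fun_prop
  refine Continuous.prodMk (Continuous.prodMk ?_ ((continuous_bankField Hx).comp h1))
    (Continuous.prodMk (Continuous.prodMk (continuous_multiplierDrift hΓ)
      ((continuous_bankField Hl).comp h2))
    (Continuous.prodMk ((hL.comp h2.fst).sub ((continuous_bankOut Hz).comp h3))
      ((continuous_bankField Hz).comp h3)))
  exact (((hΓ.continuous_F hF).comp h1.fst).neg.sub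
    (hΓ.continuous_gradGT.comp (h1.fst.prodMk h2.fst))).sub ((continuous_bankOut Hx).comp h1)

/-- Supplies local boundedness of the discontinuous field from continuity of the unprojected one. -/
theorem norm_dynamics_le {s : State n p m r q} (hs : s ∈ domain n p m r q) :
    ‖dynamics Γ net Hx Hl Hz s‖ ≤ ‖unprojectedDynamics Γ net Hx Hl Hz s‖ := by
  rw [dynamics_eq]
  have h := norm_diffProj_nonnegBlocks_le hs (multiplierDrift Γ net Hl s)
  simp only [Prod.norm_def]
  exact max_le_max le_rfl (max_le_max (max_le_max h le_rfl) le_rfl)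

/-- The states of all compensators. -/
noncomputable def compensatorStateCLM :
    State n p m r q →L[ℝ] Blocks p × Blocks r × Blocks q :=
  ((ContinuousLinearMap.snd ℝ _ _).comp (ContinuousLinearMap.fst ℝ _ _)).prod
    (((ContinuousLinearMap.snd ℝ _ _).comp
        ((ContinuousLinearMap.fst ℝ _ _).comp (ContinuousLinearMap.snd ℝ _ _))).prod
      ((ContinuousLinearMap.snd ℝ _ _).comp
        ((ContinuousLinearMap.snd ℝ _ _).comp (ContinuousLinearMap.snd ℝ _ _))))

/-- The right-hand sides of all compensators. -/
noncomputable def compensatorFieldCLM (Hx : ∀ i, LTI (p i) (n i)) (Hl : ∀ i, LTI (r i) m)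
    (Hz : ∀ i, LTI (q i) m) : State n p m r q →L[ℝ] Blocks p × Blocks r × Blocks q :=
  ((bankFieldCLM Hx).comp (ContinuousLinearMap.fst ℝ _ _)).prod
    (((bankFieldCLM Hl).comp
        ((ContinuousLinearMap.fst ℝ _ _).comp (ContinuousLinearMap.snd ℝ _ _))).prod
      ((bankFieldCLM Hz).comp
        ((ContinuousLinearMap.snd ℝ _ _).comp (ContinuousLinearMap.snd ℝ _ _))))

theorem isEquilibrium_of_isStationary (hΓ : Γ.Regular) (hF : IsMonotoneOp Γ.F)
    {s : State n p m r q} (hs : s ∈ domain n p m r q)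
    (h : IsStationary (dynamics Γ net Hx Hl Hz) (domain n p m r q) s) :
    IsEquilibrium Γ net Hx Hl Hz s := by
  have hcont : Continuous (unprojectedDynamics Γ net Hx Hl Hz) :=
    continuous_unprojectedDynamics hΓ hF
  have h1 : (dynamics Γ net Hx Hl Hz s).1 = 0 :=
    h.comp_eq_zero (ContinuousLinearMap.fst ℝ _ _) hcont.fst.continuousWithinAt
  have h2 : (dynamics Γ net Hx Hl Hz s).2.2 = 0 :=
    h.comp_eq_zero ((ContinuousLinearMap.snd ℝ _ _).comp (ContinuousLinearMap.snd ℝ _ _))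
      hcont.snd.snd.continuousWithinAt
  have h3 : (dynamics Γ net Hx Hl Hz s).2.1.2 = 0 :=
    h.comp_eq_zero ((ContinuousLinearMap.snd ℝ _ _).comp
      ((ContinuousLinearMap.fst ℝ _ _).comp (ContinuousLinearMap.snd ℝ _ _)))
      hcont.snd.fst.snd.continuousWithinAt
  have h4 : (dynamics Γ net Hx Hl Hz s).2.1.1 = 0 := by
    -- The only discontinuous component. The drift is a continuous lower bound for its projection
    -- everywhere, and equals it near `s` in entries with `λ ≠ 0`; these two facts give the sign
    -- condition and complementarity.
    refine (diffProj_nonnegBlocks_eq_zero_iff hs (multiplierDrift Γ net Hl s)).2 fun i j => ?_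
    set l : State n p m r q →L[ℝ] ℝ := (entryCLM i j).comp ((ContinuousLinearMap.fst ℝ _ _).comp
      ((ContinuousLinearMap.fst ℝ _ _).comp (ContinuousLinearMap.snd ℝ _ _))) with hl
    have hv : Continuous fun s : State n p m r q => multiplierDrift Γ net Hl s i j :=
      (entryCLM i j).continuous.comp (continuous_multiplierDrift hΓ)
    have hle : multiplierDrift Γ net Hl s i j ≤ 0 := by
      refine h.nonpos_of_le l (v := fun s => multiplierDrift Γ net Hl s i j)
        hv.continuousWithinAt ?_
      filter_upwards [self_mem_nhdsWithin] with y hy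
      exact le_diffProj_nonnegBlocks hy _ i j
    refine ⟨hle, fun hij => le_antisymm hle ?_⟩
    rw [← neg_nonpos]
    refine h.nonpos_of_le (-l) (v := fun s => -multiplierDrift Γ net Hl s i j)
      hv.neg.continuousWithinAt ?_
    have hlam : Continuous fun s : State n p m r q => s.2.1.1 i j :=
      (entryCLM i j).continuous.comp
        (continuous_fst.comp (continuous_fst.comp continuous_snd))
    filter_upwards [self_mem_nhdsWithin,
      nhdsWithin_le_nhds (hlam.continuousAt.eventually_ne hij)] with y hy hyij
    exact neg_le_neg (diffProj_nonnegBlocks_of_ne_zero hy _ hyij).le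
  exact ⟨hs, Prod.ext h1 (Prod.ext (Prod.ext h4 h3) h2)⟩

theorem IsTrajectory.isCaratheodorySolution {s : ℝ → State n p m r q}
    (hs : IsTrajectory Γ net Hx Hl Hz s) :
    IsCaratheodorySolution (dynamics Γ net Hx Hl Hz) (domain n p m r q) s :=
  ⟨hs.mem_domain, hs.absolutelyContinuous, hs.hasDerivAt⟩

/-- Under the interconnection `u_x = -∇G(x)ᵀ λ`, `u_λz = x` the two supply rates are opposite, so
only the compensator dissipation remains. -/
theorem exists_fderiv_storage_dynamics_le (hΓ : Γ.Regular) (hF : IsMonotoneOp Γ.F)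
    (hHx : ∀ i, (Hx i).IsCompensator (Px i)) (hHl : ∀ i, (Hl i).IsCompensator (Pl i))
    (hHz : ∀ i, (Hz i).IsCompensator (Pz i)) :
    ∃ a > 0, ∃ b > 0, ∃ c > 0, ∀ e, IsEquilibrium Γ net Hx Hl Hz e → ∀ s ∈ domain n p m r q,
      fderiv ℝ (fun s : State n p m r q => storageX Px e.1 s.1 + storageLZ Pl Pz e.2 s.2) s
        (dynamics Γ net Hx Hl Hz s) ≤
      -(a * ‖bankOut Hx s.1.2 s.1.1‖ ^ 2 + (b * ‖bankOut Hl s.2.1.2 s.2.1.1‖ ^ 2 +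
        c * ‖bankOut Hz s.2.2.2 s.2.2.1‖ ^ 2)) := by
  obtain ⟨a, ha, hx⟩ := exists_fderiv_storageX_sigmaXField_le (net := net) (Hl := Hl) (Hz := Hz)
    hF hHx
  obtain ⟨b, hb, c, hc, hlz⟩ := exists_fderiv_storageLZ_sigmaLZField_le (net := net) (Hx := Hx)
    hΓ hHl hHz
  refine ⟨a, ha, b, hb, c, hc, fun e he s hs => ?_⟩
  rw [fderiv_comp_fst_add_comp_snd_apply (contDiff_storageX Px e.1) (contDiff_storageLZ e.2)]
  have h1 := hx e he s.1 (-Γ.gradGT s.1.1 s.2.1.1)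
  have h2 := hlz e he s.2 hs s.1.1
  have h3 : sigmaXField Γ Hx s.1 (-Γ.gradGT s.1.1 s.2.1.1) = (dynamics Γ net Hx Hl Hz s).1 := by
    simp only [sigmaXField, dynamics, sub_eq_add_neg]
  have h4 : sigmaLZField Γ net Hl Hz s.2 s.1.1 = (dynamics Γ net Hx Hl Hz s).2 := rfl
  rw [h3, sub_neg_eq_add, neg_add_eq_sub, ← neg_sub (Γ.gradGT s.1.1 s.2.1.1), inner_neg_left,
    real_inner_comm] at h1
  rw [h4] at h2
  linarith

theorem IsTrajectory.exists_tendsto_isEquilibrium (hΓ : Γ.Regular) (hF : IsMonotoneOp Γ.F)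
    (hHx : ∀ i, (Hx i).IsCompensator (Px i)) (hHl : ∀ i, (Hl i).IsCompensator (Pl i))
    (hHz : ∀ i, (Hz i).IsCompensator (Pz i)) {e : State n p m r q}
    (he : IsEquilibrium Γ net Hx Hl Hz e) {s : ℝ → State n p m r q}
    (hs : IsTrajectory Γ net Hx Hl Hz s) :
    ∃ e', IsEquilibrium Γ net Hx Hl Hz e' ∧ Tendsto s atTop (𝓝 e') := by
  obtain ⟨a, ha, b, hb, c, hc, hdiss⟩ := exists_fderiv_storage_dynamics_le (net := net)
    hΓ hF hHx hHl hHz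
  obtain ⟨κ, hκ, hlow⟩ := exists_mul_norm_sq_le_prod
    (exists_mul_norm_sq_le_storageX n fun i => (hHx i).outputStrictlyPassive.1)
    (exists_mul_norm_sq_le_storageLZ m (fun i => (hHl i).outputStrictlyPassive.1)
      fun i => (hHz i).outputStrictlyPassive.1)
  have h1 : Continuous fun s : State n p m r q => s.1 := continuous_fst
  have h2 : Continuous fun s : State n p m r q => s.2.1 := by fun_prop
  have h3 : Continuous fun s : State n p m r q => s.2.2 := by fun_prop
  refine hs.isCaratheodorySolution.exists_tendsto_equilibrium isClosed_domain
    (S := {e | IsEquilibrium Γ net Hx Hl Hz e}) (hne := ⟨e, he⟩) (hc := hκ)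
    (V := fun e s => storageX Px e.1 s.1 + storageLZ Pl Pz e.2 s.2)
    (φ := fun s => a * ‖bankOut Hx s.1.2 s.1.1‖ ^ 2 + (b * ‖bankOut Hl s.2.1.2 s.2.1.1‖ ^ 2 +
        c * ‖bankOut Hz s.2.2.2 s.2.2.1‖ ^ 2))
    (fun R => ?_) (fun e _ => ?_) (fun e _ => ?_) (fun e _ => hlow e) hdiss ?_
    (fun s => by positivity) compensatorStateCLM (compensatorFieldCLM Hx Hl Hz) (fun s _ => rfl)
    (fun σ hσ hφ hderiv τ => ?_) fun s hs h => isEquilibrium_of_isStationary hΓ hF hs h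
  · obtain ⟨K, hK⟩ := (isCompact_closedBall (0 : State n p m r q) R).exists_bound_of_continuousOn
      (continuous_unprojectedDynamics (net := net) (Hx := Hx) (Hl := Hl) (Hz := Hz)
        hΓ hF).continuousOn
    exact ⟨K, fun x hx hxR => (norm_dynamics_le hx).trans (hK x (by simpa using hxR))⟩
  · exact ((contDiff_storageX Px e.1).comp contDiff_fst).add
      ((contDiff_storageLZ e.2).comp contDiff_snd)
  · simp only [storageLZ_eq, storageX_self, add_zero]
  · have hx := (continuous_bankOut Hx).comp h1
    have hl := (continuous_bankOut Hl).comp h2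
    have hz := (continuous_bankOut Hz).comp h3
    exact (continuous_const.mul (hx.norm.pow 2)).add
      ((continuous_const.mul (hl.norm.pow 2)).add (continuous_const.mul (hz.norm.pow 2)))
  · have hzero : ∀ t, bankOut Hx (σ t).1.2 (σ t).1.1 = 0 ∧
        bankOut Hl (σ t).2.1.2 (σ t).2.1.1 = 0 ∧ bankOut Hz (σ t).2.2.2 (σ t).2.2.1 = 0 := by
      intro t
      have h0 := hφ t
      rw [add_eq_zero_iff_of_nonneg (by positivity) (by positivity),
        add_eq_zero_iff_of_nonneg (by positivity) (by positivity)] at h0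
      simpa [ha.ne', hb.ne', hc.ne'] using h0
    have ex := const_of_bankOut_eq_zero hHx (h1.comp hσ)
      (fun t => (hderiv t).fst) (fun t => (hzero t).1) τ
    have el := const_of_bankOut_eq_zero hHl (h2.comp hσ)
      (fun t => (hderiv t).snd.fst) (fun t => (hzero t).2.1) τ
    have ez := const_of_bankOut_eq_zero hHz (h3.comp hσ)
      (fun t => (hderiv t).snd.snd) (fun t => (hzero t).2.2) τ
    exact Prod.ext ex (Prod.ext el ez)

end Convergence

end GNESeeking

theorem theorem3 {N m : ℕ} {n p r q : Fin N → ℕ}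
    (Γ : Game n m) (hΓ : Γ.Regular)
    (net : Network N) (hnet : net.graph.Connected)
    (Hx : ∀ i, LTI (p i) (n i)) (Hl : ∀ i, LTI (r i) m) (Hz : ∀ i, LTI (q i) m)
    (Px : ∀ i, Matrix (Fin (p i)) (Fin (p i)) ℝ)
    (Pl : ∀ i, Matrix (Fin (r i)) (Fin (r i)) ℝ)
    (Pz : ∀ i, Matrix (Fin (q i)) (Fin (q i)) ℝ)
    (hHx : ∀ i, (Hx i).IsCompensator (Px i))
    (hHl : ∀ i, (Hl i).IsCompensator (Pl i))
    (hHz : ∀ i, (Hz i).IsCompensator (Pz i))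
    (hF : IsMonotoneOp Γ.F)
    (e : State n p m r q) (he : IsEquilibrium Γ net Hx Hl Hz e) :
    IsPassiveAt univ (sigmaXField Γ Hx) sigmaXOut (storageX Px e.1) e.1
        (-Γ.gradGT e.1.1 e.2.1.1) ∧
      IsPassiveAt (domainLZ m r q) (sigmaLZField Γ net Hl Hz) (sigmaLZOut Γ)
        (storageLZ Pl Pz e.2) e.2 e.1.1 ∧
      ∀ s : ℝ → State n p m r q, IsTrajectory Γ net Hx Hl Hz s →
        ∃ e' : State n p m r q, IsEquilibrium Γ net Hx Hl Hz e' ∧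
          Tendsto s atTop (𝓝 e') ∧ Γ.IsVariationalGNE e'.1.1 := by
  refine ⟨isPassiveAt_sigmaX hF hHx he, isPassiveAt_sigmaLZ hΓ hHl hHz he, fun s hs => ?_⟩
  obtain ⟨e', he', hlim⟩ := hs.exists_tendsto_isEquilibrium hΓ hF hHx hHl hHz he
  exact ⟨e', he', hlim, he'.isVariationalGNE hΓ hnet hHx hHl hHz⟩
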